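/- Let $\delta>0$ and let $(X,d,\mu)$ be an Ahlfors $\delta$-regular metric-measure space: $(X,d)$ is a locally compact second-countable metric space, $\mu$ is a finite Borel measure on $X$, and there is a constant $C\ge 1$ with $$C^{-1}r^{\delta}\le \mu(\overline{B}(x,r))\le C r^{\delta}\qquad\text{for all } x\in X,\ 0\le r<\operatorname{diam}X .$$ On the real Hilbert space $L^2(X,\mu)$ consider the bilinear form $$\mathcal{E}(f,g)=\frac12\int_X\int_X\frac{(f(x)-f(y))(g(x)-g(y))}{d(x,y)^{\delta}}\,d\mu(y)\,d\mu(x)$$ (the integral being taken off the diagonal) with domain $$\operatorname{Dom}\mathcal{E}=\Big\{f\in L^2(X,\mu):\int_X\int_X\frac{|f(x)-f(y)|^2}{d(x,y)^{\delta}}\,d\mu(y)\,d\mu(x)<\infty\Big\},$$ and let $\Delta$ be the operator on $L^2(X,\mu)$ associated to $\mathcal{E}$: its graph consists of all pairs $(u,v)\in L^2(X,\mu)\times L^2(X,\mu)$ with $u\in\operatorname{Dom}\mathcal{E}$ and $\langle u,g\rangle+\mathcal{E}(u,g)=\langle u+v,g\rangle$ for all $g\in\operatorname{Dom}\mathcal{E}$.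 Then $-\Delta$ generates a unique strongly continuous one-parameter semigroup $(e^{-t\Delta})_{t\ge 0}$ of bounded operators on $L^2(X,\mu)$, and there is some $t_0>0$ such that the heat operator $e^{-t\Delta}$ is trace class for every $t>t_0$, that is, $|e^{-t\Delta}|=\big((e^{-t\Delta})^{*}e^{-t\Delta}\big)^{1/2}$ has finite trace. -/

import Mathlib

open MeasureTheory Filter Topology
open scoped NNReal ENNReal

noncomputable section

/-! ### Ahlfors regular metric-measure spaces -/

/-- A Borel measure `μ` on a metric space `X` is Ahlfors `δ`-regular if there is `C ≥ 1` with
`C⁻¹ r ^ δ ≤ μ (closedBall x r) ≤ C r ^ δ` for all `x` and all `0 ≤ r < diam X`.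
The diameter is taken in `[0, ∞]`, so that an unbounded space has infinite diameter. -/
def IsAhlforsRegular {X : Type*} [MetricSpace X] [MeasurableSpace X]
    (δ : ℝ) (μ : Measure X) : Prop :=
  ∃ C : ℝ, 1 ≤ C ∧ ∀ (x : X) (r : ℝ), 0 ≤ r → ENNReal.ofReal r < Metric.ediam (Set.univ : Set X) →
    ENNReal.ofReal (C⁻¹ * r ^ δ) ≤ μ (Metric.closedBall x r) ∧
      μ (Metric.closedBall x r) ≤ ENNReal.ofReal (C * r ^ δ)

/-! ### The operator associated to a bilinear form -/

section Form

variable {H : Type*} [NormedAddCommGroup H] [InnerProductSpace ℝ H]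

/-- The graph of the operator associated to a bilinear form `Q` with domain `D ⊆ H`:
`(u, v)` belongs to it iff `u ∈ D` and `u` is the image of `u + v` under the form resolvent `R`,
which is determined by `⟪R f, g⟫ + Q (R f) g = ⟪f, g⟫` for all `g ∈ D`.
In other words it consists of the pairs `(R f, f - R f)`. -/
def formOperatorGraph (D : Submodule ℝ H) (Q : LinearMap.BilinForm ℝ D) :
    Submodule ℝ (H × H) where
  carrier := {p | ∃ u : D, (u : H) = p.1 ∧
    ∀ g : D, inner ℝ (u : H) (g : H) + Q u g = inner ℝ (p.1 + p.2) (g : H)}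
  zero_mem' := ⟨0, by simp, by simp⟩
  add_mem' := by
    rintro ⟨a, b⟩ ⟨a', b'⟩ ⟨u, hu, h⟩ ⟨u', hu', h'⟩
    refine ⟨u + u', by simp_all, fun g => ?_⟩
    have h1 := h g
    have h2 := h' g
    simp only [Prod.fst_add, Prod.snd_add, map_add, LinearMap.add_apply, Submodule.coe_add,
      inner_add_left] at *
    linarith
  smul_mem' := by
    rintro c ⟨a, b⟩ ⟨u, hu, h⟩
    refine ⟨c • u, by simp_all, fun g => ?_⟩
    have h1 := h g
    simp only [Prod.smul_fst, Prod.smul_snd, map_smul, LinearMap.smul_apply, Submodule.coe_smul,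
      ← smul_add, real_inner_smul_left, smul_eq_mul] at *
    rw [← h1]
    ring

/-- The (in general unbounded) operator associated to a densely defined closed form. -/
def formOperator (D : Submodule ℝ H) (Q : LinearMap.BilinForm ℝ D) : H →ₗ.[ℝ] H :=
  (formOperatorGraph D Q).toLinearPMap

end Form

/-! ### Semigroups and trace class operators -/

section Operators

variable {H : Type*} [NormedAddCommGroup H] [InnerProductSpace ℝ H]

/-- `S t = e ^ (-t A)` for all `t ≥ 0`, i.e. `S` is the strongly continuous one-parameter
semigroup of bounded operators whose infinitesimal generator is `-A`, domains included: `f` is in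
the domain of `A` with `A f = g` iff `(f - S t f) / t → g` as `t → 0+`. -/
structure IsHeatSemigroup (A : H →ₗ.[ℝ] H) (S : ℝ≥0 → H →L[ℝ] H) : Prop where
  map_zero : S 0 = ContinuousLinearMap.id ℝ H
  map_add : ∀ s t, S (s + t) = (S s).comp (S t)
  continuous : ∀ f : H, Continuous fun t => S t f
  generator : ∀ f g : H, (f, g) ∈ A.graph ↔
    Tendsto (fun t : ℝ≥0 => (t : ℝ)⁻¹ • (f - S t f)) (𝓝[>] 0) (𝓝 g)

/-- A bounded operator `T` on a Hilbert space is trace class if the trace of `|T|` is finite, where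
`|T| = (T* T) ^ (1/2)` is the (unique) positive operator whose square is `T* T` and the trace
`∑ ⟪|T| bᵢ, bᵢ⟫` is computed in an orthonormal basis (its value does not depend on the basis). -/
def IsTraceClass {H : Type*} [NormedAddCommGroup H] [InnerProductSpace ℝ H] [CompleteSpace H]
    (T : H →L[ℝ] H) : Prop :=
  ∃ P : H →L[ℝ] H, P.IsPositive ∧ P.comp P = (ContinuousLinearMap.adjoint T).comp T ∧
    ∃ (w : Set H) (b : HilbertBasis w ℝ H), Summable fun i => inner ℝ (P (b i)) (b i)

end Operators

/-! ### The logarithmic Dirichlet Laplacian -/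

section LogLaplacian

set_option linter.unusedSectionVars false

variable {X : Type*} [MetricSpace X] [SecondCountableTopology X] [MeasurableSpace X] [BorelSpace X]

/-- The integrand `(f x - f y) (g x - g y) / d(x, y) ^ δ` of the form. It vanishes on the
diagonal, so integrals over `X × X` are integrals over the complement of the diagonal. -/
def logKernel (δ : ℝ) (f g : X → ℝ) (p : X × X) : ℝ :=
  (f p.1 - f p.2) * (g p.1 - g p.2) / dist p.1 p.2 ^ δ

variable (δ : ℝ) (μ : Measure X) [IsFiniteMeasure μ]

lemma measurable_logKernel (f g : Lp ℝ 2 μ) : Measurable (logKernel δ f g) := by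
  have hf := (Lp.stronglyMeasurable f).measurable
  have hg := (Lp.stronglyMeasurable g).measurable
  unfold logKernel
  fun_prop

lemma logKernel_add (f f' g : Lp ℝ 2 μ) :
    logKernel δ ⇑(f + f') ⇑g =ᵐ[μ.prod μ] logKernel δ f g + logKernel δ f' g := by
  have h := Lp.coeFn_add f f'
  filter_upwards [Measure.quasiMeasurePreserving_fst.ae h,
    Measure.quasiMeasurePreserving_snd.ae h] with p h1 h2
  simp only [logKernel, Pi.add_apply, h1, h2]
  ring

lemma logKernel_smul (c : ℝ) (f g : Lp ℝ 2 μ) :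
    logKernel δ ⇑(c • f) ⇑g =ᵐ[μ.prod μ] c • logKernel δ f g := by
  have h := Lp.coeFn_smul c f
  filter_upwards [Measure.quasiMeasurePreserving_fst.ae h,
    Measure.quasiMeasurePreserving_snd.ae h] with p h1 h2
  simp only [logKernel, Pi.smul_apply, smul_eq_mul, h1, h2]
  ring

lemma logKernel_comm (f g : X → ℝ) : logKernel δ f g = logKernel δ g f := by
  funext p
  simp only [logKernel]
  ring

lemma integrable_logKernel {f g : Lp ℝ 2 μ} (hf : Integrable (logKernel δ f f) (μ.prod μ))
    (hg : Integrable (logKernel δ g g) (μ.prod μ)) : Integrable (logKernel δ f g) (μ.prod μ) := by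
  refine (hf.add hg).mono' (measurable_logKernel δ μ f g).aestronglyMeasurable
    (Eventually.of_forall fun p => ?_)
  have hd : 0 ≤ dist p.1 p.2 ^ δ := Real.rpow_nonneg dist_nonneg _
  simp only [logKernel, Pi.add_apply, Real.norm_eq_abs]
  rw [abs_div, abs_of_nonneg hd, ← add_div]
  refine div_le_div_of_nonneg_right ?_ hd
  rw [abs_le]
  constructor <;> nlinarith [sq_nonneg (f p.1 - f p.2 + (g p.1 - g p.2)),
    sq_nonneg (f p.1 - f p.2 - (g p.1 - g p.2))]

/-- The domain of the form: all `f ∈ L²(X, μ)` with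
`∫∫ |f x - f y| ^ 2 / d(x, y) ^ δ dμ dμ < ∞` (the integrand is nonnegative and measurable). -/
def logFormDomain : Submodule ℝ (Lp ℝ 2 μ) where
  carrier := {f | Integrable (logKernel δ f f) (μ.prod μ)}
  zero_mem' := by
    have h := logKernel_smul δ μ 0 0 0
    rw [zero_smul, zero_smul] at h
    exact (integrable_zero _ _ _).congr h.symm
  add_mem' := by
    intro f g (hf : Integrable _ _) (hg : Integrable _ _)
    have hfg := integrable_logKernel δ μ hf hg
    have h1 : Integrable (logKernel δ ⇑(f + g) ⇑f) (μ.prod μ) :=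
      (hf.add (logKernel_comm δ f g ▸ hfg)).congr (logKernel_add δ μ f g f).symm
    have h2 : Integrable (logKernel δ ⇑(f + g) ⇑g) (μ.prod μ) :=
      (hfg.add hg).congr (logKernel_add δ μ f g g).symm
    rw [logKernel_comm] at h1 h2
    exact (h1.add h2).congr (logKernel_add δ μ f g (f + g)).symm
  smul_mem' := by
    intro c f (hf : Integrable _ _)
    have h1 : Integrable (logKernel δ ⇑(c • f) ⇑f) (μ.prod μ) :=
      (hf.smul c).congr (logKernel_smul δ μ c f f).symm
    rw [logKernel_comm] at h1
    exact (h1.smul c).congr (logKernel_smul δ μ c f (c • f)).symm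

/-- The form `ℰ(f, g) = 1/2 ∫∫ (f x - f y) (g x - g y) / d(x, y) ^ δ dμ(y) dμ(x)`, as an integral with
respect to the product measure (the integrand is integrable for `f`, `g` in the form domain). -/
def logForm : LinearMap.BilinForm ℝ (logFormDomain δ μ) :=
  LinearMap.mk₂ ℝ
    (fun f g => (1 / 2 : ℝ) * ∫ p, logKernel δ (f : Lp ℝ 2 μ) (g : Lp ℝ 2 μ) p ∂(μ.prod μ))
    (fun f f' g => by
      rw [Submodule.coe_add, integral_congr_ae (logKernel_add δ μ f f' g),
        integral_add' (integrable_logKernel δ μ f.2 g.2) (integrable_logKernel δ μ f'.2 g.2),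
        mul_add])
    (fun c f g => by
      rw [Submodule.coe_smul, integral_congr_ae (logKernel_smul δ μ c f g)]
      simp only [Pi.smul_apply, smul_eq_mul, integral_const_mul]
      ring)
    (fun f g g' => by
      simp only [logKernel_comm δ (f : Lp ℝ 2 μ)]
      rw [Submodule.coe_add, integral_congr_ae (logKernel_add δ μ g g' f),
        integral_add' (integrable_logKernel δ μ g.2 f.2) (integrable_logKernel δ μ g'.2 f.2),
        mul_add])
    (fun c f g => by
      simp only [logKernel_comm δ (f : Lp ℝ 2 μ)]
      rw [Submodule.coe_smul, integral_congr_ae (logKernel_smul δ μ c g f)]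
      simp only [Pi.smul_apply, smul_eq_mul, integral_const_mul]
      ring)

/-- The logarithmic Dirichlet Laplacian `Δ` of `(X, d, μ)`, as an unbounded operator on the real
Hilbert space `L²(X, μ)`: the operator associated to the form `ℰ`. -/
def logDirichletLaplacian : Lp ℝ 2 μ →ₗ.[ℝ] Lp ℝ 2 μ :=
  formOperator (logFormDomain δ μ) (logForm δ μ)

end LogLaplacian

end

/-! ### Closed forms, their resolvents and the count of eigenvalues -/

section FormResolvent

variable {H K : Type*} [NormedAddCommGroup H] [InnerProductSpace ℝ H]
  [NormedAddCommGroup K] [InnerProductSpace ℝ K]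
  {D : Submodule ℝ H} {Q : LinearMap.BilinForm ℝ D}

/-! The energy controls `f` only weakly, but it controls all dyadic scales at once. At scale `r k =
r₀ / 2 ^ k`, replace `f` by its averages over balls centred at a finite net. By Jensen and the lower
ball bound, the squared error is at most a constant times `r k ^ (-δ) ∫∫_{d ≤ 2 r k} |f x - f y|²`.
Since `∑ k, r k ^ (-δ) 1_{d ≤ 2 r k}` is a geometric sum of size about `d ^ (-δ)`, the errors at all
scales together are bounded by the energy (`sum_nearDiff_le_logKernel`). Let `V m` be spanned by the
step functions of the first `m` scales. Projection to `V m` is at least as good as each of the `m`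
approximations, so `m * ‖f - P f‖² ≤ c * ℰ(f, f)`, while packing disjoint balls gives `dim V m ≤ B *
q ^ m` (`exists_submodule_approx_logForm`).

The form is `⟪T u, T v⟫` for a closed difference-quotient operator `T`, with domain dense by the
upper ball bound. The estimate makes its resolvent compact, so the Laplacian is diagonal with
eigenvalues `l i ≥ 0`, and at most `dim V m` of them are `≤ a` once `c * a < m`
(`exists_hilbertBasis_formOperator`). The counting function thus grows at most exponentially, and `∑
exp (-t * l i)` converges for `t > c * log q` (`summable_exp_neg_of_card_le`). Uniqueness follows
because any semigroup with this generator solves a linear ODE on each eigenvector. -/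

/-- The resolvent of a closed form `Q u v = ⟪T u, T v⟫`. -/
lemma exists_form_resolvent [CompleteSpace H] [CompleteSpace K]
    (T : D →ₗ[ℝ] K) (hQ : ∀ u v, Q u v = inner ℝ (T u) (T v))
    (hT : IsClosed {p : H × K | ∃ u : D, (u : H) = p.1 ∧ T u = p.2}) :
    ∃ R : H →L[ℝ] H, ∀ f, ∃ u : D, (u : H) = R f ∧
      ∀ g : D, inner ℝ (u : H) (g : H) + Q u g = inner ℝ f (g : H) := by
  let J : D →ₗ[ℝ] WithLp 2 (H × K) :=
    (WithLp.linearEquiv 2 ℝ (H × K)).symm.toLinearMap ∘ₗ D.subtype.prod T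
  let G := LinearMap.range J
  have hG : IsClosed (G : Set (WithLp 2 (H × K))) := by
    have : (G : Set (WithLp 2 (H × K))) =
        (WithLp.prodContinuousLinearEquiv 2 ℝ H K) ⁻¹'
          {p : H × K | ∃ u : D, (u : H) = p.1 ∧ T u = p.2} := by
      ext x
      constructor
      · rintro ⟨u, rfl⟩
        exact ⟨u, rfl, rfl⟩
      · rintro ⟨u, h1, h2⟩
        refine ⟨u, ?_⟩
        apply (WithLp.prodContinuousLinearEquiv 2 ℝ H K).injective
        exact Prod.ext h1 h2
    rw [this]
    exact hT.preimage (WithLp.prodContinuousLinearEquiv 2 ℝ H K).continuous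
  have : CompleteSpace G := hG.completeSpace_coe
  let ι : H →L[ℝ] WithLp 2 (H × K) :=
    (WithLp.prodContinuousLinearEquiv 2 ℝ H K).symm.toContinuousLinearMap ∘L
      ContinuousLinearMap.inl ℝ H K
  let π : WithLp 2 (H × K) →L[ℝ] H :=
    ContinuousLinearMap.fst ℝ H K ∘L
      (WithLp.prodContinuousLinearEquiv 2 ℝ H K).toContinuousLinearMap
  -- Project `(f, 0)` orthogonally to the graph of `T`. If `(u, T u)` is the projection,
  -- orthogonality of `(f - u, -T u)` to every `(g, T g)` is the weak equation.
  refine ⟨π ∘L G.starProjection ∘L ι, fun f => ?_⟩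
  obtain ⟨u, hu⟩ : G.starProjection (ι f) ∈ G := Submodule.starProjection_apply_mem _ _
  refine ⟨u, ?_, fun g => ?_⟩
  · change (u : H) = π (G.starProjection (ι f))
    rw [← hu]
    rfl
  · have h := G.starProjection_inner_eq_zero (ι f) (J g) ⟨g, rfl⟩
    rw [← hu, inner_sub_left, WithLp.prod_inner_apply, WithLp.prod_inner_apply] at h
    have h' : inner ℝ f (g : H) + inner ℝ (0 : K) (T g) -
      (inner ℝ (u : H) (g : H) + inner ℝ (T u) (T g)) = 0 := h
    rw [inner_zero_left] at h'
    rw [hQ]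
    linarith

/-- `R` maps `f` to the solution `u` of `⟪u, g⟫ + Q u g = ⟪f, g⟫`. -/
def IsFormResolvent (Q : LinearMap.BilinForm ℝ D) (R : H →L[ℝ] H) : Prop :=
  ∀ f, ∃ u : D, (u : H) = R f ∧ ∀ g : D, inner ℝ (u : H) (g : H) + Q u g = inner ℝ f (g : H)

lemma IsFormResolvent.inner_comm {R : H →L[ℝ] H} (hR : IsFormResolvent Q R)
    (hsymm : ∀ u v, Q u v = Q v u) (f g : H) : inner ℝ (R f) g = inner ℝ f (R g) := by
  obtain ⟨u, hu, h1⟩ := hR f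
  obtain ⟨v, hv, h2⟩ := hR g
  have h1 := h1 v
  have h2 := h2 u
  rw [← hu, ← hv, ← h1, real_inner_comm, ← h2, hsymm u v, real_inner_comm]

/-- The weak equation has only one solution: tested on itself, the difference `w` of two solutions
gives `‖w‖² + Q w w = 0`. Questions about the unbounded operator thus become questions about `R`. -/
lemma IsFormResolvent.mem_graph_iff {R : H →L[ℝ] H} (hR : IsFormResolvent Q R)
    (hpos : ∀ u, 0 ≤ Q u u) {p : H × H} :
    p ∈ formOperatorGraph D Q ↔ R (p.1 + p.2) = p.1 := by
  obtain ⟨u, hu, h⟩ := hR (p.1 + p.2)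
  constructor
  · rintro ⟨v, hv, h'⟩
    have h1 := h (u - v)
    have h2 := h' (u - v)
    rw [← h1] at h2
    have h3 := hpos (u - v)
    have h4 : inner ℝ ((u - v : D) : H) ((u - v : D) : H) + Q (u - v) (u - v) = 0 := by
      have h6 : Q (u - v) (u - v) = Q u (u - v) - Q v (u - v) := by
        rw [map_sub Q, LinearMap.sub_apply]
      have h7 : inner ℝ ((u - v : D) : H) ((u - v : D) : H) =
          inner ℝ (u : H) ((u - v : D) : H) - inner ℝ (v : H) ((u - v : D) : H) := by
        rw [← inner_sub_left, ← Submodule.coe_sub]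
      linarith
    have h5 : inner ℝ ((u - v : D) : H) ((u - v : D) : H) = 0 :=
      le_antisymm (by linarith) real_inner_self_nonneg
    rw [inner_self_eq_zero, Submodule.coe_sub, sub_eq_zero] at h5
    rw [← hu, h5, hv]
  · intro hp
    exact ⟨u, hu.trans hp, h⟩

/-- Density makes the relation single-valued, as `toLinearPMap` needs to reproduce it as its graph:
if `(0, v)` belongs to it, then `v` is orthogonal to `D`. -/
lemma mem_graph_formOperator_iff (hD : Dense (D : Set H)) {p : H × H} :
    p ∈ (formOperator D Q).graph ↔ p ∈ formOperatorGraph D Q := by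
  rw [formOperator, Submodule.toLinearPMap_graph_eq]
  rintro ⟨_, v⟩ ⟨u, hu, h⟩ rfl
  have hu0 : u = 0 := Subtype.ext hu
  refine hD.eq_zero_of_inner_left (𝕜 := ℝ) fun g hg => ?_
  have := h ⟨g, hg⟩
  simp only [hu0, map_zero, LinearMap.zero_apply, zero_add, ZeroMemClass.coe_zero,
    inner_zero_left] at this
  exact this.symm

/-- A bounded operator all of whose values are well approximated in finite dimensional subspaces
is compact. -/
lemma isCompactOperator_of_finiteDimensional_approx [CompleteSpace H] (R : H →L[ℝ] H)
    (V : ℕ → Submodule ℝ H)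
    [∀ m, FiniteDimensional ℝ (V m)] (c : ℝ) (hc : 0 ≤ c)
    (h : ∀ m f, m * ‖R f - (V m).starProjection (R f)‖ ^ 2 ≤ c * ‖f‖ ^ 2) :
    IsCompactOperator R := by
  refine isCompactOperator_of_tendsto (l := atTop)
    (F := fun m : ℕ => (V m).starProjection ∘L R) ?_ (Eventually.of_forall fun m => ?_)
  · rw [tendsto_iff_norm_sub_tendsto_zero]
    have hlim : Tendsto (fun m : ℕ => √(c / m)) atTop (𝓝 0) := by
      have := (tendsto_const_div_atTop_nhds_zero_nat c).sqrt
      simpa using this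
    refine squeeze_zero' (Eventually.of_forall fun _ => norm_nonneg _) ?_ hlim
    filter_upwards [eventually_gt_atTop 0] with m hm
    have hm' : (0 : ℝ) < m := by exact_mod_cast hm
    refine ContinuousLinearMap.opNorm_le_bound _ (Real.sqrt_nonneg _) fun f => ?_
    have h1 := h m f
    have h2 : ‖R f - (V m).starProjection (R f)‖ ^ 2 ≤ (√(c / m) * ‖f‖) ^ 2 := by
      rw [mul_pow, Real.sq_sqrt (by positivity), div_mul_eq_mul_div, le_div_iff₀ hm']
      linarith
    have h3 := le_of_sq_le_sq h2 (by positivity)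
    rw [norm_sub_rev] at h3
    exact h3
  · have h1 : IsCompactOperator ((V m).subtypeL) :=
      isCompactOperator_of_locallyCompactSpace_rng ((V m).subtypeL)
    exact h1.comp_clm ((V m).orthogonalProjectionOnto ∘L R)

/-- A compact symmetric operator has a Hilbert basis of eigenvectors. -/
lemma exists_hilbertBasis_eigenvectors [CompleteSpace H] (R : H →L[ℝ] H)
    (hc : IsCompactOperator R)
    (hs : (R : H →ₗ[ℝ] H).IsSymmetric) :
    ∃ (w : Set H) (b : HilbertBasis w ℝ H) (r : w → ℝ), ∀ i, R (b i) = r i • b i := by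
  classical
  let E : ℝ → Submodule ℝ H := fun a => Module.End.eigenspace (R : Module.End ℝ H) a
  have hE : ∀ a, IsClosed (E a : Set H) := fun a => by
    have : (E a : Set H) = {x | R x = a • x} := by
      ext x
      exact Module.End.mem_eigenspace_iff
    rw [this]
    exact isClosed_eq R.continuous (continuous_const_smul a)
  have : ∀ a, CompleteSpace (E a) := fun a => (hE a).completeSpace_coe
  choose w b hb using fun a => exists_hilbertBasis ℝ (E a)
  -- Pool orthonormal bases of the eigenspaces over all real `a`; those with `a` not an eigenvalue
  -- contribute nothing. By the spectral theorem for compact symmetric operators, the union has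
  -- trivial orthogonal complement.
  let W : Set H := {x | ∃ a, ∃ y ∈ w a, (y : H) = x}
  have hW : Orthonormal ℝ (Subtype.val : W → H) := by
    have hon : ∀ a, Orthonormal ℝ (Subtype.val : w a → E a) := fun a => by
      have := (b a).orthonormal
      rwa [hb] at this
    rw [orthonormal_subtype_iff_ite]
    rintro _ ⟨a, y, hy, rfl⟩ _ ⟨a', y', hy', rfl⟩
    by_cases haa : a = a'
    · subst haa
      have h := orthonormal_subtype_iff_ite.1 (hon a) y hy y' hy'
      rw [Submodule.coe_inner] at h
      rw [h]
      simp
    · have h0 : inner ℝ (y : H) (y' : H) = 0 :=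
        hs.orthogonalFamily_eigenspaces haa y y'
      rw [h0, if_neg]
      intro h
      rw [← h, real_inner_self_eq_norm_sq] at h0
      have h1 := (hon a).1 ⟨y, hy⟩
      have h2 : ‖(y : H)‖ = 1 := h1
      rw [h2] at h0
      norm_num at h0
  have hsp : (Submodule.span ℝ (Set.range (Subtype.val : W → H)))ᗮ = ⊥ := by
    rw [eq_bot_iff, ← ContinuousLinearMap.orthogonalComplement_iSup_eigenspaces_eq_bot hc hs,
      ← Submodule.iInf_orthogonal]
    intro x hx
    rw [Submodule.mem_iInf]
    intro a
    rw [Submodule.mem_orthogonal]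
    intro v hv
    have h1 := (b a).hasSum_repr ⟨v, hv⟩
    have h2 := ((innerSL ℝ x) ∘L (E a).subtypeL).hasSum h1
    have h3 : ∀ i, ((innerSL ℝ x) ∘L (E a).subtypeL) ((b a).repr ⟨v, hv⟩ i • b a i) = 0 := by
      intro i
      rw [map_smul]
      have : ((innerSL ℝ x) ∘L (E a).subtypeL) (b a i) = inner ℝ x ((b a i : E a) : H) := rfl
      rw [this, hb, real_inner_comm,
        (Submodule.mem_orthogonal _ x).1 hx _ (Submodule.subset_span ⟨⟨_, a, i, i.2, rfl⟩, rfl⟩),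
        smul_zero]
    have h4 : ((innerSL ℝ x) ∘L (E a).subtypeL) ⟨v, hv⟩ = 0 := by
      refine h2.unique ?_
      simp only [h3]
      exact hasSum_zero
    rw [real_inner_comm]
    exact h4
  refine ⟨W, HilbertBasis.mkOfOrthogonalEqBot hW hsp, fun i => i.2.choose, fun i => ?_⟩
  rw [HilbertBasis.coe_mkOfOrthogonalEqBot]
  obtain ⟨y, -, hy⟩ := i.2.choose_spec
  have := Module.End.mem_eigenspace_iff.1 y.2
  rw [← hy]
  exact this

/-- The operator of a densely defined closed form with good finite dimensional approximations is
diagonal with nonnegative eigenvalues in some Hilbert basis. The eigenvalue counting function is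
controlled by the approximation. -/
theorem exists_hilbertBasis_formOperator [CompleteSpace H] [CompleteSpace K]
    (T : D →ₗ[ℝ] K) (hQ : ∀ u v, Q u v = inner ℝ (T u) (T v))
    (hT : IsClosed {p : H × K | ∃ u : D, (u : H) = p.1 ∧ T u = p.2}) (hD : Dense (D : Set H))
    (V : ℕ → Submodule ℝ H) [∀ m, FiniteDimensional ℝ (V m)] (c : ℝ) (hc : 0 ≤ c)
    (hV : ∀ m (f : D), m * ‖(f : H) - (V m).starProjection f‖ ^ 2 ≤ c * Q f f) :
    ∃ (w : Set H) (b : HilbertBasis w ℝ H) (l : w → ℝ), (∀ i, 0 ≤ l i) ∧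
      (∀ f g, (f, g) ∈ (formOperator D Q).graph ↔ ∀ i, b.repr g i = l i * b.repr f i) ∧
      ∀ (m : ℕ) (a : ℝ), c * a < m → ∀ s : Finset w, (∀ i ∈ s, l i ≤ a) →
        s.card ≤ Module.finrank ℝ (V m) := by
  have hpos : ∀ u, 0 ≤ Q u u := fun u => by rw [hQ]; exact real_inner_self_nonneg
  have hsymm : ∀ u v, Q u v = Q v u := fun u v => by rw [hQ, hQ, real_inner_comm]
  obtain ⟨R, hR⟩ := exists_form_resolvent T hQ hT
  have hR : IsFormResolvent Q R := hR
  have hRs : (R : H →ₗ[ℝ] H).IsSymmetric := fun f g => hR.inner_comm hsymm f g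
  have hcomp : IsCompactOperator R := by
    refine isCompactOperator_of_finiteDimensional_approx R V c hc fun m f => ?_
    obtain ⟨u, hu, h⟩ := hR f
    rw [← hu]
    refine (hV m u).trans (mul_le_mul_of_nonneg_left ?_ hc)
    have h1 := h u
    have h2 : inner ℝ f (u : H) ≤ ‖f‖ * ‖(u : H)‖ := real_inner_le_norm _ _
    rw [real_inner_self_eq_norm_sq] at h1
    -- Testing the equation with `u` itself gives `Q u u = ⟪f, u⟫ - ‖u‖² ≤ ‖f‖²`.
    nlinarith [sq_nonneg (‖f‖ - ‖(u : H)‖), sq_nonneg (‖(u : H)‖)]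
  obtain ⟨w, b, r, hb⟩ := exists_hilbertBasis_eigenvectors R hcomp hRs
  have hbn : ∀ i, ‖b i‖ = 1 := b.orthonormal.1
  have hr0 : ∀ i, r i ≠ 0 := by
    intro i hi
    obtain ⟨u, hu, h⟩ := hR (b i)
    rw [hb, hi, zero_smul] at hu
    have hu0 : u = 0 := by exact_mod_cast hu
    have hbi : b i = 0 := by
      refine hD.eq_zero_of_inner_left (𝕜 := ℝ) fun g hg => ?_
      have := h ⟨g, hg⟩
      simpa [hu0] using this.symm
    have := hbn i
    rw [hbi, norm_zero] at this
    norm_num at this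
  -- Testing the equation for `R (b i)` on itself gives `r i ^ 2 + Q u u = r i`. Hence `0 < r i ≤
  -- 1`, and the eigenvalue `(r i)⁻¹ - 1` of the operator is nonnegative.
  have hr : ∀ i, r i ^ 2 ≤ r i := by
    intro i
    obtain ⟨u, hu, h⟩ := hR (b i)
    have h1 := h u
    rw [hu, hb, inner_smul_left, inner_smul_right, real_inner_self_eq_norm_sq, hbn] at h1
    have := hpos u
    simp only [conj_trivial, one_pow, mul_one] at h1
    nlinarith
  have hrpos : ∀ i, 0 < r i := fun i =>
    lt_of_le_of_ne ((sq_nonneg _).trans (hr i)) (hr0 i).symm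
  have hr1 : ∀ i, r i ≤ 1 := fun i => by
    have := hr i
    have := hrpos i
    nlinarith
  have hgraph : ∀ f g, (f, g) ∈ formOperatorGraph D Q ↔
      ∀ i, b.repr g i = ((r i)⁻¹ - 1) * b.repr f i := by
    intro f g
    rw [hR.mem_graph_iff hpos]
    have hco : ∀ i, b.repr (R (f + g)) i = r i * (b.repr f i + b.repr g i) := by
      intro i
      rw [b.repr_apply_apply, ← hR.inner_comm hsymm, hb, inner_smul_left, inner_add_right,
        ← b.repr_apply_apply, ← b.repr_apply_apply]
      simp
    constructor
    · intro h i
      have h1 := hco i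
      simp only at h
      rw [h] at h1
      have := hr0 i
      field_simp
      linarith
    · intro h
      simp only
      apply b.repr.injective
      ext i
      rw [hco, h i]
      have := hr0 i
      field_simp
      ring
  refine ⟨w, b, fun i => (r i)⁻¹ - 1, fun i => ?_, fun f g => ?_, fun m a ham s hs => ?_⟩
  · have := (one_le_inv₀ (hrpos i)).2 (hr1 i)
    linarith
  · rw [mem_graph_formOperator_iff hD, hgraph]
  -- With more than `dim (V m)` eigenvectors, some nonzero combination `x` is orthogonal to `V m`.
  -- Then `m * ‖x‖² ≤ c * Q x x ≤ c * a * ‖x‖²`, contrary to `c * a < m`.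
  · by_contra! hlt
    let L : (s → ℝ) →ₗ[ℝ] V m := (V m).orthogonalProjectionOnto.toLinearMap ∘ₗ
      Fintype.linearCombination ℝ (fun i : s => b i)
    have hker : LinearMap.ker L ≠ ⊥ := by
      refine LinearMap.ker_ne_bot_of_finrank_lt ?_
      simpa using hlt
    obtain ⟨z, hz, hz0⟩ := (Submodule.ne_bot_iff _).1 hker
    set x : H := ∑ i : s, z i • b i with hx
    set v : H := ∑ i : s, (((r i)⁻¹ - 1) * z i) • b i with hv
    have hxP : (V m).starProjection x = 0 := by
      have : (V m).orthogonalProjectionOnto x = 0 := by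
        have := LinearMap.mem_ker.1 hz
        simp only [L, LinearMap.comp_apply, Fintype.linearCombination_apply] at this
        exact this
      rw [Submodule.starProjection_apply, this]
      rfl
    have hxv : (x, v) ∈ formOperatorGraph D Q := by
      have : (x, v) = ∑ i : s, z i • (b i, ((r i)⁻¹ - 1) • b i) := by
        rw [Prod.ext_iff, Prod.fst_sum, Prod.snd_sum]
        refine ⟨by simp [hx], ?_⟩
        rw [hv]
        refine Finset.sum_congr rfl fun i _ => ?_
        rw [Prod.smul_snd, smul_smul, mul_comm]
      rw [this]
      refine Submodule.sum_mem _ fun i _ => Submodule.smul_mem _ _ ?_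
      rw [hR.mem_graph_iff hpos]
      simp only [map_add, map_smul, hb, ← add_smul, smul_smul]
      rw [← one_smul ℝ (b i), smul_smul]
      congr 1
      have := hr0 i
      field_simp
      ring
    have hon : Orthonormal ℝ (fun i : s => b i) := b.orthonormal.comp _ Subtype.val_injective
    have hnx : ‖x‖ ^ 2 = ∑ i : s, z i ^ 2 := by
      rw [← real_inner_self_eq_norm_sq, hx, hon.inner_sum]
      simp [sq]
    have hvx : inner ℝ v x = ∑ i : s, ((r i)⁻¹ - 1) * z i ^ 2 := by
      rw [hx, hv, hon.inner_sum]
      simp [sq, mul_assoc]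
    obtain ⟨u, hu, h⟩ := hxv
    have h1 := h u
    simp only at hu h1
    rw [hu, inner_add_left] at h1
    have hQu : Q u u = inner ℝ v x := by linarith
    have h2 := hV m u
    rw [hu, hxP, sub_zero, hQu, hvx, hnx] at h2
    have h3 : ∑ i : s, ((r i)⁻¹ - 1) * z i ^ 2 ≤ a * ∑ i : s, z i ^ 2 := by
      rw [Finset.mul_sum]
      exact Finset.sum_le_sum fun i _ => mul_le_mul_of_nonneg_right (hs i i.2) (sq_nonneg _)
    have h4 : 0 < ∑ i : s, z i ^ 2 := by
      obtain ⟨i, hi⟩ := Function.ne_iff.1 hz0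
      exact Finset.sum_pos' (fun _ _ => sq_nonneg _) ⟨i, Finset.mem_univ _, by
        have : z i ≠ 0 := hi
        positivity⟩
    have h5 := mul_le_mul_of_nonneg_left h3 hc
    nlinarith

end FormResolvent

/-! ### Semigroups and traces of diagonal operators -/

section DiagonalSemigroup

variable {H ι : Type*} [NormedAddCommGroup H] [InnerProductSpace ℝ H]

lemma HilbertBasis.hasSum_repr_mul_repr (b : HilbertBasis ι ℝ H) (x y : H) :
    HasSum (fun i => b.repr x i * b.repr y i) (inner ℝ x y) := by
  have h := b.hasSum_inner_mul_inner x y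
  simp only [b.repr_apply_apply]
  convert! h using 3
  exact real_inner_comm _ _

lemma HilbertBasis.hasSum_repr_sq (b : HilbertBasis ι ℝ H) (x : H) :
    HasSum (fun i => b.repr x i ^ 2) (‖x‖ ^ 2) := by
  simpa only [sq, real_inner_self_eq_norm_mul_norm] using b.hasSum_repr_mul_repr x x

/-- Contractive diagonal operators exist. -/
lemma HilbertBasis.exists_diagonal (b : HilbertBasis ι ℝ H) (a : ι → ℝ) (ha : ∀ i, |a i| ≤ 1) :
    ∃ S : H →L[ℝ] H, ∀ f i, b.repr (S f) i = a i * b.repr f i := by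
  have hle : ∀ f i, (a i * b.repr f i) ^ 2 ≤ b.repr f i ^ 2 := fun f i => by
    rw [mul_pow]
    have : a i ^ 2 ≤ 1 := (sq_le_one_iff_abs_le_one _).2 (ha i)
    nlinarith [sq_nonneg (b.repr f i)]
  have hmem : ∀ f, Memℓp (fun i => a i * b.repr f i) 2 := fun f => by
    refine memℓp_gen ?_
    simp only [ENNReal.toReal_ofNat, Real.rpow_two, Real.norm_eq_abs, sq_abs]
    exact (b.hasSum_repr_sq f).summable.of_nonneg_of_le (fun _ => sq_nonneg _) (hle f)
  let L : H →ₗ[ℝ] H :=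
    { toFun := fun f => b.repr.symm ⟨fun i => a i * b.repr f i, hmem f⟩
      map_add' := fun f g => by
        rw [← map_add]
        congr 1
        ext i
        simp only [map_add, lp.coeFn_add, Pi.add_apply, mul_add]
      map_smul' := fun c f => by
        rw [RingHom.id_apply, ← map_smul]
        congr 1
        ext i
        simp only [map_smul, lp.coeFn_smul, Pi.smul_apply, smul_eq_mul]
        ring }
  have hL : ∀ f i, b.repr (L f) i = a i * b.repr f i := fun f i => by
    simp only [L, LinearMap.coe_mk, AddHom.coe_mk, LinearIsometryEquiv.apply_symm_apply]
  refine ⟨L.mkContinuous 1 fun f => ?_, hL⟩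
  rw [one_mul]
  refine le_of_sq_le_sq ?_ (norm_nonneg _)
  refine hasSum_le (fun i => ?_) (b.hasSum_repr_sq (L f)) (b.hasSum_repr_sq f)
  rw [hL]
  exact hle f i

/-- Dominated convergence for coordinates in a Hilbert basis. -/
lemma HilbertBasis.tendsto_of_dominated (b : HilbertBasis ι ℝ H) {α : Type*} {l : Filter α}
    {F : α → H} {x : H} (y : H)
    (hF : ∀ i, Tendsto (fun s => b.repr (F s) i) l (𝓝 (b.repr x i)))
    (hy : ∀ᶠ s in l, ∀ i, |b.repr (F s) i| ≤ |b.repr y i|) : Tendsto F l (𝓝 x) := by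
  rw [tendsto_iff_norm_sub_tendsto_zero]
  have h1 : Tendsto (fun s => ∑' i, (b.repr (F s) i - b.repr x i) ^ 2) l (𝓝 (∑' _ : ι, (0 : ℝ))) := by
    refine tendsto_tsum_of_dominated_convergence
      (bound := fun i => 2 * b.repr y i ^ 2 + 2 * b.repr x i ^ 2)
      (((b.hasSum_repr_sq y).summable.mul_left 2).add ((b.hasSum_repr_sq x).summable.mul_left 2))
      (fun i => ?_) ?_
    · have := ((hF i).sub_const (b.repr x i)).pow 2
      simpa using this
    · filter_upwards [hy] with s hs i
      rw [Real.norm_eq_abs, abs_of_nonneg (sq_nonneg _)]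
      have := sq_le_sq.2 (hs i)
      nlinarith [sq_nonneg (b.repr (F s) i + b.repr x i)]
  have h2 : ∀ s, ∑' i, (b.repr (F s) i - b.repr x i) ^ 2 = ‖F s - x‖ ^ 2 := fun s => by
    rw [← (b.hasSum_repr_sq (F s - x)).tsum_eq]
    simp
  simp only [h2, tsum_zero] at h1
  have h3 := h1.sqrt
  simpa using h3

variable {A : H →ₗ.[ℝ] H} {S : ℝ≥0 → H →L[ℝ] H}

/-- If `A` is diagonal with nonnegative eigenvalues `l i`, then the diagonal operators with
entries `exp (-t * l i)` form the semigroup generated by `-A`. -/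
lemma HilbertBasis.isHeatSemigroup (b : HilbertBasis ι ℝ H) {l : ι → ℝ} (hl : ∀ i, 0 ≤ l i)
    (hA : ∀ f g, (f, g) ∈ A.graph ↔ ∀ i, b.repr g i = l i * b.repr f i)
    (hS : ∀ t f i, b.repr (S t f) i = Real.exp (-(t * l i)) * b.repr f i) :
    IsHeatSemigroup A S := by
  have hmem : Set.Ioi (0 : ℝ≥0) ∈ 𝓝[>] (0 : ℝ≥0) := self_mem_nhdsWithin
  have hco : ∀ (f : H) (t : ℝ≥0) i, b.repr ((t : ℝ)⁻¹ • (f - S t f)) i =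
      (t : ℝ)⁻¹ * (1 - Real.exp (-(t * l i))) * b.repr f i := fun f t i => by
    simp only [map_smul, map_sub, lp.coeFn_smul, lp.coeFn_sub, Pi.smul_apply, Pi.sub_apply, hS,
      smul_eq_mul]
    ring
  have hlim : ∀ (f : H) i, Tendsto (fun t : ℝ≥0 => b.repr ((t : ℝ)⁻¹ • (f - S t f)) i) (𝓝[>] 0)
      (𝓝 (l i * b.repr f i)) := by
    intro f i
    simp only [hco]
    refine Tendsto.mul_const _ ?_
    have hd : HasDerivAt (fun t : ℝ => 1 - Real.exp (-(t * l i))) (l i) 0 := by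
      have h := (((hasDerivAt_id (0 : ℝ)).mul_const (l i)).neg.exp).const_sub 1
      simpa using h
    have h2 := (hasDerivAt_iff_tendsto_slope.1 hd).mono_left
      (nhdsWithin_mono (0 : ℝ) (fun x (hx : x ∈ Set.Ioi (0 : ℝ)) => (ne_of_gt hx : x ≠ 0)))
    have h3 : Tendsto (fun t : ℝ≥0 => (t : ℝ)) (𝓝[>] 0) (𝓝[>] 0) := by
      refine tendsto_nhdsWithin_iff.2 ⟨?_, ?_⟩
      · exact (NNReal.continuous_coe.tendsto' 0 0 rfl).mono_left nhdsWithin_le_nhds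
      · filter_upwards [hmem] with t ht
        exact_mod_cast ht
    refine (h2.comp h3).congr fun t => ?_
    simp [slope, mul_comm]
  refine ⟨?_, fun s t => ?_, fun f => ?_, fun f g => ?_⟩
  · ext f
    apply b.repr.injective
    ext i
    simp [hS]
  · ext f
    apply b.repr.injective
    ext i
    rw [ContinuousLinearMap.comp_apply, hS, hS, hS, ← mul_assoc, ← Real.exp_add]
    congr 2
    push_cast
    ring
  · refine continuous_iff_continuousAt.2 fun t => ?_
    refine b.tendsto_of_dominated f (fun i => ?_) (Eventually.of_forall fun s i => ?_)
    · simp only [hS]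
      have : Continuous fun s : ℝ≥0 => Real.exp (-((s : ℝ) * l i)) * b.repr f i := by fun_prop
      exact this.tendsto t
    · rw [hS, abs_mul, Real.abs_exp]
      refine mul_le_of_le_one_left (abs_nonneg _) (Real.exp_le_one_iff.2 ?_)
      have := mul_nonneg s.2 (hl i)
      simpa using this
  · rw [hA]
    constructor
    · intro h
      refine b.tendsto_of_dominated g (fun i => ?_) ?_
      · rw [h i]
        exact hlim f i
      · filter_upwards [hmem] with t ht i
        have ht : (0 : ℝ) < t := by exact_mod_cast ht
        -- From `1 - exp (-x) ≤ x`, the difference quotient in coordinate `i` is at most `l i * |f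
        -- i| = |g i|`, so `g` itself is the dominating vector.
        rw [hco, h i, abs_mul, abs_mul (l i)]
        refine mul_le_mul_of_nonneg_right ?_ (abs_nonneg _)
        have h1 : Real.exp (-(t * l i)) ≤ 1 := by
          refine Real.exp_le_one_iff.2 ?_
          have := mul_nonneg ht.le (hl i)
          linarith
        have h2 := Real.add_one_le_exp (-(t * l i))
        rw [abs_of_nonneg (hl i), abs_of_nonneg (by
          have := inv_pos.2 ht
          exact mul_nonneg this.le (by linarith)), inv_mul_le_iff₀ ht]
        linarith
    · intro h i
      have h1 : Tendsto (fun t : ℝ≥0 => b.repr ((t : ℝ)⁻¹ • (f - S t f)) i) (𝓝[>] 0)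
          (𝓝 (b.repr g i)) := by
        simp only [b.repr_apply_apply]
        exact tendsto_const_nhds.inner h
      exact tendsto_nhds_unique h1 (hlim f i)

/-- A heat semigroup acts on eigenvectors by exponentials. -/
lemma IsHeatSemigroup.apply_eigenvector (hS : IsHeatSemigroup A S) {f : H} {l : ℝ}
    (hf : (f, l • f) ∈ A.graph) (t : ℝ≥0) : S t f = Real.exp (-(t * l)) • f := by
  let G : ℝ → H := fun s => S s.toNNReal f
  have hG : Continuous G := (hS.continuous f).comp continuous_real_toNNReal
  have hgen := (hS.generator f (l • f)).1 hf
  -- The semigroup law carries the generator limit at `0` to a right derivative at every `x ≥ 0`.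
  -- This suffices to make `exp (l * x) • G x` constant, as `G` is continuous.
  have hder : ∀ x : ℝ, 0 ≤ x → HasDerivWithinAt G (-(l • G x)) (Set.Ici x) x := by
    intro x hx
    rw [hasDerivWithinAt_iff_tendsto_slope, Set.Ici_sdiff_left]
    have h1 : Tendsto (fun y : ℝ => (y - x).toNNReal) (𝓝[>] x) (𝓝[>] 0) := by
      refine tendsto_nhdsWithin_iff.2 ⟨?_, ?_⟩
      · have : Continuous fun y : ℝ => (y - x).toNNReal := by fun_prop
        exact (this.tendsto' x 0 (by simp)).mono_left nhdsWithin_le_nhds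
      · filter_upwards [self_mem_nhdsWithin] with y hy
        exact Real.toNNReal_pos.2 (sub_pos.2 hy)
    have h2 := (((S x.toNNReal).continuous.tendsto _).comp (hgen.comp h1)).neg
    rw [map_smul] at h2
    refine h2.congr' ?_
    filter_upwards [self_mem_nhdsWithin] with y hy
    have hxy : 0 < y - x := sub_pos.2 hy
    have h3 : S y.toNNReal f = S x.toNNReal (S (y - x).toNNReal f) := by
      rw [← ContinuousLinearMap.comp_apply, ← hS.map_add, ← Real.toNNReal_add hx hxy.le]
      congr 3
      ring
    simp only [Function.comp_apply, map_smul, map_sub, slope, vsub_eq_sub, G, h3,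
      Real.coe_toNNReal _ hxy.le]
    rw [← smul_neg, neg_sub]
  have hconst : ∀ x ∈ Set.Icc (0 : ℝ) t, Real.exp (l * x) • G x = Real.exp (l * 0) • G 0 := by
    refine constant_of_has_deriv_right_zero (f := fun x => Real.exp (l * x) • G x)
      (Continuous.continuousOn (by fun_prop)) fun x hx => ?_
    have he : HasDerivAt (fun x : ℝ => Real.exp (l * x)) (Real.exp (l * x) * l) x := by
      simpa using ((hasDerivAt_id x).const_mul l).exp
    have := he.hasDerivWithinAt.smul (hder x hx.1)
    convert! this using 1
    rw [smul_neg, smul_smul, neg_add_cancel]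
  have h := hconst t ⟨t.2, le_rfl⟩
  simp only [G, Real.toNNReal_coe, mul_zero, Real.exp_zero, one_smul, Real.toNNReal_zero,
    hS.map_zero, ContinuousLinearMap.id_apply] at h
  conv_rhs => rw [← h, smul_smul, ← Real.exp_add, mul_comm l, neg_add_cancel, Real.exp_zero,
    one_smul]

/-- A diagonal operator generates at most one semigroup. -/
lemma IsHeatSemigroup.eq_of_hilbertBasis {S' : ℝ≥0 → H →L[ℝ] H} (hS : IsHeatSemigroup A S)
    (hS' : IsHeatSemigroup A S') (b : HilbertBasis ι ℝ H) (l : ι → ℝ)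
    (hb : ∀ i, (b i, l i • b i) ∈ A.graph) : S' = S := by
  funext t
  refine ContinuousLinearMap.ext_on (s := Set.range b) ?_ ?_
  · rw [Submodule.dense_iff_topologicalClosure_eq_top]
    exact b.dense_span
  · rintro _ ⟨i, rfl⟩
    rw [hS.apply_eigenvector (hb i), hS'.apply_eigenvector (hb i)]

/-- A nonnegative diagonal operator with summable entries is trace class. -/
lemma HilbertBasis.isTraceClass [CompleteSpace H] {w : Set H} (b : HilbertBasis w ℝ H)
    {a : w → ℝ} (ha : ∀ i, 0 ≤ a i) (hsum : Summable a) {T : H →L[ℝ] H}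
    (hT : ∀ f i, b.repr (T f) i = a i * b.repr f i) : IsTraceClass T := by
  have hsymm : ∀ f g, inner ℝ (T f) g = inner ℝ f (T g) := fun f g => by
    refine (b.hasSum_repr_mul_repr (T f) g).unique ?_
    convert! b.hasSum_repr_mul_repr f (T g) using 2 with i
    rw [hT, hT]
    ring
  have hpos : T.IsPositive := by
    refine ⟨hsymm, fun f => ?_⟩
    simp only [ContinuousLinearMap.reApplyInnerSelf_apply]
    change 0 ≤ inner ℝ (T f) f
    refine (b.hasSum_repr_mul_repr (T f) f).nonneg fun i => ?_
    rw [hT, mul_assoc]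
    exact mul_nonneg (ha i) (mul_self_nonneg _)
  -- Being positive, `T` is its own absolute value.
  refine ⟨T, hpos, by rw [hpos.isSelfAdjoint.adjoint_eq], w, b, ?_⟩
  refine hsum.congr fun i => ?_
  have h := hT (b i) i
  rw [b.repr_apply_apply, b.repr_apply_apply, real_inner_self_eq_norm_sq, b.orthonormal.1] at h
  rw [real_inner_comm, h]
  simp

/-- If the counting function of `l` grows at most exponentially, then `exp (-t * l i)` is summable
for large `t`. -/
lemma summable_exp_neg_of_card_le {l : ι → ℝ} (hl : ∀ i, 0 ≤ l i) {c B q : ℝ}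
    (hc : 0 < c) (hq : 1 ≤ q) (hB : 0 ≤ B)
    (hcard : ∀ (m : ℕ) (a : ℝ), c * a < m → ∀ s : Finset ι, (∀ i ∈ s, l i ≤ a) →
      (s.card : ℝ) ≤ B * q ^ m) {t : ℝ} (ht : c * Real.log q < t) :
    Summable fun i => Real.exp (-(t * l i)) := by
  have hq0 : 0 < q := by linarith
  have ht0 : 0 < t := lt_of_le_of_lt (mul_nonneg hc.le (Real.log_nonneg hq)) ht
  set ρ := Real.exp (-(t / c)) with hρ
  have hρ0 : 0 < ρ := Real.exp_pos _
  have hqρ : q * ρ < 1 := by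
    rw [hρ, ← Real.exp_log hq0, ← Real.exp_add, Real.exp_lt_one_iff,
      ← sub_eq_add_neg, sub_neg, lt_div_iff₀ hc]
    linarith
  have hgeo : Summable fun n : ℕ => B * q ^ 2 * (q * ρ) ^ n :=
    (summable_geometric_of_lt_one (by positivity) hqρ).mul_left _
  refine summable_of_sum_le (c := ∑' n : ℕ, B * q ^ 2 * (q * ρ) ^ n)
    (fun i => (Real.exp_pos _).le) fun s => ?_
  -- Sort the indices by `n = ⌊c * l i⌋₊`. Class `n` contributes at most its cardinality times `ρ ^
  -- n`, and `q * ρ < 1` is the condition `t > c * log q`.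
  have hbound : ∀ i, Real.exp (-(t * l i)) ≤ ρ ^ ⌊c * l i⌋₊ := fun i => by
    rw [hρ, ← Real.exp_nat_mul, Real.exp_le_exp]
    have h1 := Nat.floor_le (mul_nonneg hc.le (hl i))
    have h2 : (⌊c * l i⌋₊ : ℝ) * (t / c) ≤ (c * l i) * (t / c) :=
      mul_le_mul_of_nonneg_right h1 (by positivity)
    have h3 : (c * l i) * (t / c) = t * l i := by field_simp
    linarith
  calc ∑ i ∈ s, Real.exp (-(t * l i)) ≤ ∑ i ∈ s, ρ ^ ⌊c * l i⌋₊ :=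
        Finset.sum_le_sum fun i _ => hbound i
    _ = ∑ n ∈ s.image (fun i => ⌊c * l i⌋₊), (s.filter (fun i => ⌊c * l i⌋₊ = n)).card • ρ ^ n :=
        Finset.sum_comp (fun n => ρ ^ n) _
    _ ≤ ∑ n ∈ s.image (fun i => ⌊c * l i⌋₊), B * q ^ 2 * (q * ρ) ^ n := by
        refine Finset.sum_le_sum fun n _ => ?_
        -- Class `n` has `l i ≤ (n + 1) / c`; the strict inequality in `hcard` then forces `n + 2`.
        have h1 := hcard (n + 2) ((n + 1) / c) (by
          rw [mul_div_cancel₀ _ hc.ne']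
          push_cast
          linarith) (s.filter (fun i => ⌊c * l i⌋₊ = n)) (fun i hi => by
            have h2 := (Finset.mem_filter.1 hi).2
            have h3 := Nat.lt_floor_add_one (c * l i)
            rw [h2] at h3
            rw [le_div_iff₀ hc]
            linarith)
        rw [nsmul_eq_mul]
        refine (mul_le_mul_of_nonneg_right h1 (by positivity)).trans (le_of_eq ?_)
        ring
    _ ≤ _ := hgeo.sum_le_tsum _ fun n _ => by positivity

end DiagonalSemigroup

/-! ### The logarithmic form: closedness and density of its domain -/

section LogForm

variable {X : Type*} [MetricSpace X] [SecondCountableTopology X] [MeasurableSpace X] [BorelSpace X]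
  {δ : ℝ} {μ : Measure X} [IsFiniteMeasure μ]

omit [SecondCountableTopology X] [BorelSpace X] [IsFiniteMeasure μ] in
lemma logKernel_congr {f f' g g' : X → ℝ} [SFinite μ]
    (hf : f =ᵐ[μ] f') (hg : g =ᵐ[μ] g') :
    logKernel δ f g =ᵐ[μ.prod μ] logKernel δ f' g' := by
  filter_upwards [Measure.quasiMeasurePreserving_fst.ae hf,
    Measure.quasiMeasurePreserving_snd.ae hf, Measure.quasiMeasurePreserving_fst.ae hg,
    Measure.quasiMeasurePreserving_snd.ae hg] with p h1 h2 h3 h4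
  simp only [logKernel, h1, h2, h3, h4]

omit [SecondCountableTopology X] [MeasurableSpace X] [BorelSpace X] in
lemma logKernel_self_nonneg (f : X → ℝ) (p : X × X) : 0 ≤ logKernel δ f f p :=
  div_nonneg (mul_self_nonneg _) (Real.rpow_nonneg dist_nonneg _)

/-- The difference quotient `(f x - f y) / √(2 d(x, y) ^ δ)`. -/
noncomputable def logGradient (δ : ℝ) (f : X → ℝ) (p : X × X) : ℝ :=
  (f p.1 - f p.2) / √(2 * dist p.1 p.2 ^ δ)

omit [SecondCountableTopology X] [MeasurableSpace X] [BorelSpace X] in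
lemma logGradient_mul_logGradient (f g : X → ℝ) (p : X × X) :
    logGradient δ f p * logGradient δ g p = 1 / 2 * logKernel δ f g p := by
  have h : 0 ≤ 2 * dist p.1 p.2 ^ δ := mul_nonneg zero_le_two (Real.rpow_nonneg dist_nonneg _)
  rw [logGradient, logGradient, logKernel, div_mul_div_comm, Real.mul_self_sqrt h,
    div_mul_div_comm, one_mul]

omit [IsFiniteMeasure μ] in
lemma measurable_logGradient (f : Lp ℝ 2 μ) : Measurable (logGradient δ f) := by
  have hf := (Lp.stronglyMeasurable f).measurable
  unfold logGradient
  fun_prop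

lemma memLp_logGradient {f : Lp ℝ 2 μ} :
    MemLp (logGradient δ f) 2 (μ.prod μ) ↔ f ∈ logFormDomain δ μ := by
  rw [memLp_two_iff_integrable_sq (measurable_logGradient f).aestronglyMeasurable]
  simp only [sq, logGradient_mul_logGradient]
  rw [integrable_const_mul_iff (by norm_num)]
  rfl

/-- The difference quotient as a linear map on the form domain. -/
noncomputable def logGradientLp (δ : ℝ) (μ : Measure X) [IsFiniteMeasure μ] :
    logFormDomain δ μ →ₗ[ℝ] Lp ℝ 2 (μ.prod μ) where
  toFun f := (memLp_logGradient.2 f.2).toLp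
  map_add' f g := by
    rw [← MemLp.toLp_add]
    refine MemLp.toLp_congr _ _ ?_
    have h := Lp.coeFn_add (f : Lp ℝ 2 μ) (g : Lp ℝ 2 μ)
    filter_upwards [Measure.quasiMeasurePreserving_fst.ae h,
      Measure.quasiMeasurePreserving_snd.ae h] with p h1 h2
    simp only [logGradient, Submodule.coe_add, Pi.add_apply, h1, h2]
    ring
  map_smul' c f := by
    rw [RingHom.id_apply, ← MemLp.toLp_const_smul]
    refine MemLp.toLp_congr _ _ ?_
    have h := Lp.coeFn_smul c (f : Lp ℝ 2 μ)
    filter_upwards [Measure.quasiMeasurePreserving_fst.ae h,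
      Measure.quasiMeasurePreserving_snd.ae h] with p h1 h2
    simp only [logGradient, Submodule.coe_smul, Pi.smul_apply, smul_eq_mul, h1, h2]
    ring

lemma coeFn_logGradientLp (f : logFormDomain δ μ) :
    logGradientLp δ μ f =ᵐ[μ.prod μ] logGradient δ (f : Lp ℝ 2 μ) :=
  MemLp.coeFn_toLp (memLp_logGradient.2 f.2)

/-- The `2` under the root in `logGradient` absorbs the `1 / 2` of the form. Symmetry and positivity
are then automatic, and closedness of the form becomes closedness of an operator. -/
lemma logForm_eq_inner (f g : logFormDomain δ μ) :
    logForm δ μ f g = inner ℝ (logGradientLp δ μ f) (logGradientLp δ μ g) := by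
  rw [L2.inner_def, logForm, LinearMap.mk₂_apply, ← integral_const_mul]
  refine integral_congr_ae ?_
  filter_upwards [coeFn_logGradientLp f, coeFn_logGradientLp g] with p h1 h2
  rw [h1, h2, ← logGradient_mul_logGradient]
  exact mul_comm _ _

/-- `L²` convergence gives a.e. convergence along a subsequence, and difference quotients pass to
pointwise limits. The limit lies in the domain because the domain contains every `f` with
square-integrable quotient. -/
lemma isClosed_graph_logGradientLp :
    IsClosed {p : Lp ℝ 2 μ × Lp ℝ 2 (μ.prod μ) |
      ∃ u : logFormDomain δ μ, (u : Lp ℝ 2 μ) = p.1 ∧ logGradientLp δ μ u = p.2} := by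
  refine IsSeqClosed.isClosed fun s p hs hp => ?_
  choose u hu1 hu2 using hs
  obtain ⟨φ, hφ, h1⟩ := (tendstoInMeasure_of_tendsto_Lp
    ((continuous_fst.tendsto p).comp hp)).exists_seq_tendsto_ae
  obtain ⟨ψ, hψ, h2⟩ := (tendstoInMeasure_of_tendsto_Lp
    (((continuous_snd.tendsto p).comp hp).comp hφ.tendsto_atTop)).exists_seq_tendsto_ae
  have hae : logGradient δ p.1 =ᵐ[μ.prod μ] p.2 := by
    have h3 : ∀ᵐ x ∂μ.prod μ, ∀ n, logGradientLp δ μ (u n) x =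
        logGradient δ (u n : Lp ℝ 2 μ) x := ae_all_iff.2 fun n => coeFn_logGradientLp (u n)
    filter_upwards [Measure.quasiMeasurePreserving_fst.ae h1,
      Measure.quasiMeasurePreserving_snd.ae h1, h2, h3] with x hx1 hx2 hx3 hx4
    have h5 := ((hx1.comp hψ.tendsto_atTop).sub (hx2.comp hψ.tendsto_atTop)).div_const
      (√(2 * dist x.1 x.2 ^ δ))
    refine tendsto_nhds_unique h5 (hx3.congr fun n => ?_)
    simp only [Function.comp_apply, ← hu2, ← hu1, hx4]
    rfl
  have hmem : p.1 ∈ logFormDomain δ μ :=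
    memLp_logGradient.1 ((memLp_congr_ae hae).2 (Lp.memLp p.2))
  exact ⟨⟨p.1, hmem⟩, rfl, Lp.ext ((coeFn_logGradientLp _).trans hae)⟩

omit [SecondCountableTopology X] [MeasurableSpace X] [BorelSpace X] in
lemma exists_pos_ofReal_lt_ediam [Nontrivial X] :
    ∃ r : ℝ, 0 < r ∧ ENNReal.ofReal r < Metric.ediam (Set.univ : Set X) := by
  obtain ⟨x, y, hxy⟩ := exists_pair_ne X
  have h := dist_pos.2 hxy
  refine ⟨dist x y / 2, by positivity, ?_⟩
  refine lt_of_lt_of_le ?_ (Metric.edist_le_ediam_of_mem (Set.mem_univ x) (Set.mem_univ y))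
  rw [edist_dist]
  exact (ENNReal.ofReal_lt_ofReal_iff h).2 (by linarith)

lemma measurableSet_dist_le (r : ℝ) : MeasurableSet {p : X × X | dist p.1 p.2 ≤ r} :=
  (isClosed_le continuous_dist continuous_const).measurableSet

/-- If balls of radius `r` have measure at most `b`, then so has the `r`-neighbourhood of the
diagonal, up to the total mass. -/
lemma measure_prod_dist_le {r : ℝ} {b : ℝ≥0∞} (h : ∀ x, μ (Metric.closedBall x r) ≤ b) :
    (μ.prod μ) {p : X × X | dist p.1 p.2 ≤ r} ≤ b * μ Set.univ := by
  rw [Measure.prod_apply (measurableSet_dist_le r)]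
  refine (lintegral_mono (g := fun _ => b) fun x => ?_).trans (lintegral_const b).le
  refine (measure_mono fun y hy => ?_).trans (h x)
  rw [Metric.mem_closedBall, dist_comm]
  exact hy

/-- Bounded Lipschitz functions have finite energy. -/
lemma integrable_logKernel_of_lipschitzWith (hδ : 0 < δ) (hμ : IsAhlforsRegular δ μ)
    {f : X → ℝ} {K : ℝ≥0} (hf : LipschitzWith K f) (hf0 : ∀ x, 0 ≤ f x) (hf1 : ∀ x, f x ≤ 1) :
    Integrable (logKernel δ f f) (μ.prod μ) := by
  have hmeas : Measurable (logKernel δ f f) := by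
    have := hf.continuous.measurable
    unfold logKernel
    fun_prop
  rcases subsingleton_or_nontrivial X with hX | hX
  · have : logKernel δ f f = 0 := by
      funext p
      simp [logKernel, Subsingleton.elim p.1 p.2]
    rw [this]
    exact integrable_zero _ _ _
  obtain ⟨C, hC, hball⟩ := hμ
  obtain ⟨r₀, hr₀, hdiam⟩ := exists_pos_ofReal_lt_ediam (X := X)
  let r : ℕ → ℝ := fun k => r₀ * (1 / 2) ^ k
  have hr : ∀ k, 0 < r k := fun k => by positivity
  have hrs : ∀ k, r (k + 1) = r k / 2 := fun k => by simp only [r]; ring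
  -- On the shell `r (k + 1) < d ≤ r k` the kernel is at most `a k`, and the shell has measure at
  -- most `C * r k ^ δ * μ X`. The powers `δ` cancel up to `2 ^ δ`, leaving terms of order `4 ^
  -- (-k)`.
  let a : ℕ → ℝ := fun k => K ^ 2 * r k ^ 2 / r (k + 1) ^ δ
  have ha : ∀ k, 0 ≤ a k := fun k => by
    have := hr k
    have := hr (k + 1)
    positivity
  have hpt : ∀ p, ENNReal.ofReal (logKernel δ f f p) ≤ ENNReal.ofReal (1 / r₀ ^ δ) +
      ∑' k, ENNReal.ofReal (a k) * {p : X × X | dist p.1 p.2 ≤ r k}.indicator 1 p := by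
    intro p
    rcases lt_or_ge r₀ (dist p.1 p.2) with hd | hd
    · refine le_trans (ENNReal.ofReal_le_ofReal ?_) le_self_add
      refine div_le_div₀ zero_le_one ?_ (by positivity)
        (Real.rpow_le_rpow hr₀.le hd.le hδ.le)
      nlinarith [hf0 p.1, hf0 p.2, hf1 p.1, hf1 p.2]
    · refine le_trans ?_ le_add_self
      rcases (dist_nonneg (x := p.1) (y := p.2)).eq_or_lt with h0 | h0
      · have h1 : p.1 = p.2 := dist_eq_zero.1 h0.symm
        simp [logKernel, h1]
      obtain ⟨k, hk1, hk2⟩ := exists_nat_pow_near_of_lt_one (div_pos h0 hr₀)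
        ((div_le_one hr₀).2 hd) (y := (1 / 2 : ℝ)) (by norm_num) (by norm_num)
      rw [lt_div_iff₀ hr₀, mul_comm] at hk1
      rw [div_le_iff₀ hr₀, mul_comm] at hk2
      refine le_trans ?_ (ENNReal.le_tsum k)
      rw [Set.indicator_of_mem (show p ∈ {p : X × X | dist p.1 p.2 ≤ r k} from hk2),
        Pi.one_apply, mul_one]
      refine ENNReal.ofReal_le_ofReal ?_
      have hl : |f p.1 - f p.2| ≤ K * r k := by
        rw [← Real.dist_eq]
        exact (hf.dist_le_mul _ _).trans (mul_le_mul_of_nonneg_left hk2 K.2)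
      have hl2 := sq_le_sq' (by linarith [abs_le.1 hl |>.1]) (abs_le.1 hl).2
      refine div_le_div₀ (by have := hr k; positivity) ?_ (by have := hr (k + 1); positivity)
        (Real.rpow_le_rpow (hr _).le hk1.le hδ.le)
      rw [← mul_pow, ← sq]
      exact hl2
  refine ⟨hmeas.aestronglyMeasurable, ?_⟩
  rw [hasFiniteIntegral_iff_ofReal (Eventually.of_forall (logKernel_self_nonneg f))]
  refine lt_of_le_of_lt (lintegral_mono hpt) ?_
  rw [lintegral_add_left measurable_const, lintegral_const, lintegral_tsum fun k =>
    ((measurable_one.indicator (measurableSet_dist_le _)).const_mul _).aemeasurable]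
  refine ENNReal.add_lt_top.2 ⟨by finiteness, ?_⟩
  have hterm : ∀ k, ∫⁻ p, ENNReal.ofReal (a k) *
      {p : X × X | dist p.1 p.2 ≤ r k}.indicator 1 p ∂(μ.prod μ) ≤
      ENNReal.ofReal (K ^ 2 * C * 2 ^ δ * r₀ ^ 2 * (1 / 4) ^ k) * μ Set.univ := by
    intro k
    rw [lintegral_const_mul _ (measurable_one.indicator (measurableSet_dist_le _)),
      lintegral_indicator_one (measurableSet_dist_le _)]
    have hle : r k ≤ r₀ := mul_le_of_le_one_right hr₀.le (pow_le_one₀ (by norm_num) (by norm_num))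
    have h1 := measure_prod_dist_le (μ := μ) fun x =>
      (hball x (r k) (hr k).le ((ENNReal.ofReal_le_ofReal hle).trans_lt hdiam)).2
    refine (mul_le_mul_right h1 _).trans (le_of_eq ?_)
    rw [← mul_assoc, ← ENNReal.ofReal_mul (ha k)]
    congr 2
    simp only [a]
    rw [hrs, Real.div_rpow (hr k).le zero_le_two]
    have h2 : 0 < r k ^ δ := Real.rpow_pos_of_pos (hr k) _
    have h3 : (0 : ℝ) < 2 ^ δ := by positivity
    have h4 : (r k) ^ 2 = r₀ ^ 2 * (1 / 4) ^ k := by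
      simp only [r]
      rw [mul_pow, ← pow_mul, mul_comm k 2, pow_mul]
      norm_num
    rw [h4]
    field_simp
  refine (ENNReal.tsum_le_tsum hterm).trans_lt ?_
  rw [ENNReal.tsum_mul_right]
  refine ENNReal.mul_lt_top ?_ (measure_lt_top _ _)
  have hs : Summable fun k : ℕ => K ^ 2 * C * 2 ^ δ * r₀ ^ 2 * (1 / 4 : ℝ) ^ k :=
    (summable_geometric_of_lt_one (by norm_num) (by norm_num)).mul_left _
  exact hs.tsum_ofReal_lt_top

/-- The form domain is dense. -/
lemma dense_logFormDomain (hδ : 0 < δ) (hμ : IsAhlforsRegular δ μ) :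
    Dense (logFormDomain δ μ : Set (Lp ℝ 2 μ)) := by
  rw [Submodule.dense_iff_topologicalClosure_eq_top, Submodule.topologicalClosure_eq_top_iff,
    Submodule.eq_bot_iff]
  intro v hv
  have hvi : Integrable v μ := (Lp.memLp v).integrable one_le_two
  rw [Lp.eq_zero_iff_ae_eq_zero]
  refine ae_eq_zero_of_forall_setIntegral_isClosed_eq_zero hvi fun F hF => ?_
  have hpos : ∀ n : ℕ, (0 : ℝ) < 1 / (n + 1) := fun n => by positivity
  -- Lipschitz cutoffs decreasing to the indicator of `F` lie in the domain. A vector `v` orthogonal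
  -- to all of them has zero integral over each closed set `F`.
  let φ : ℕ → X → ℝ := fun n x => thickenedIndicator (hpos n) F x
  have hφ0 : ∀ n x, 0 ≤ φ n x := fun n x => NNReal.coe_nonneg _
  have hφ1 : ∀ n x, φ n x ≤ 1 := fun n x =>
    NNReal.coe_le_one.2 (thickenedIndicator_le_one (hpos n) F x)
  have hφl : ∀ n : ℕ, LipschitzWith (1 / (n + 1) : ℝ).toNNReal⁻¹ (φ n) := fun n =>
    lipschitzWith_thickenedIndicator (hpos n) F
  have hφm : ∀ n, MemLp (φ n) 2 μ := fun n =>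
    MemLp.of_bound (hφl n).continuous.aestronglyMeasurable 1
      (Eventually.of_forall fun x => by
        rw [Real.norm_eq_abs, abs_of_nonneg (hφ0 n x)]
        exact hφ1 n x)
  have hint : ∀ n, ∫ x, φ n x * v x ∂μ = 0 := by
    intro n
    have hmem : (hφm n).toLp ∈ logFormDomain δ μ :=
      (integrable_logKernel_of_lipschitzWith hδ hμ (hφl n) (hφ0 n) (hφ1 n)).congr
        (logKernel_congr (hφm n).coeFn_toLp.symm (hφm n).coeFn_toLp.symm)
    rw [← (Submodule.mem_orthogonal _ v).1 hv _ hmem, L2.inner_def]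
    refine integral_congr_ae ?_
    filter_upwards [(hφm n).coeFn_toLp] with x hx
    rw [hx]
    exact mul_comm _ _
  have hlim : Tendsto (fun n => ∫ x, φ n x * v x ∂μ) atTop (𝓝 (∫ x, F.indicator v x ∂μ)) := by
    refine tendsto_integral_of_dominated_convergence (fun x => ‖v x‖)
      (fun n => (hφm n).1.mul hvi.1) hvi.norm (fun n => Eventually.of_forall fun x => ?_)
      (Eventually.of_forall fun x => ?_)
    · rw [norm_mul, Real.norm_eq_abs, abs_of_nonneg (hφ0 n x)]
      exact mul_le_of_le_one_left (norm_nonneg _) (hφ1 n x)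
    · have h := (tendsto_pi_nhds.1 (thickenedIndicator_tendsto_indicator_closure hpos
        tendsto_one_div_add_atTop_nhds_zero_nat F)) x
      rw [hF.closure_eq] at h
      have h2 := ((NNReal.continuous_coe.tendsto _).comp h).mul_const (v x)
      have h3 : F.indicator v x = ((F.indicator (fun _ => (1 : ℝ≥0)) x : ℝ≥0) : ℝ) * v x := by
        by_cases hx : x ∈ F <;> simp [hx]
      rw [h3]
      exact h2
  simp only [hint] at hlim
  rw [← integral_indicator hF.measurableSet]
  exact tendsto_nhds_unique hlim tendsto_const_nhds

end LogForm

/-! ### Multiscale approximation by step functions -/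

section Approximation

/-- A geometric sum is comparable to its largest term, which is at most `A`. The bound does not
depend on `m`, the number of scales. -/
lemma sum_geometric_le_of_threshold {q A : ℝ} (hq : 1 < q) (hA : 0 ≤ A) (m : ℕ) :
    ∑ k ∈ Finset.range m, (if q ^ k ≤ A then q ^ k else 0) ≤ q / (q - 1) * A := by
  have hq1 : 0 < q - 1 := sub_pos.2 hq
  induction m with
  | zero =>
    simp only [Finset.range_zero, Finset.sum_empty]
    positivity
  | succ m ih =>
    by_cases h : q ^ m ≤ A
    · have h1 : ∑ k ∈ Finset.range (m + 1), (if q ^ k ≤ A then q ^ k else 0) ≤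
          ∑ k ∈ Finset.range (m + 1), q ^ k := by
        refine Finset.sum_le_sum fun k _ => ?_
        split_ifs
        · exact le_rfl
        · positivity
      refine h1.trans ?_
      rw [geom_sum_eq hq.ne', div_mul_eq_mul_div, div_le_div_iff_of_pos_right hq1, pow_succ]
      nlinarith
    · rw [Finset.sum_range_succ, if_neg h, add_zero]
      exact ih

variable {X : Type*} [MetricSpace X] [SecondCountableTopology X] [MeasurableSpace X] [BorelSpace X]
  {δ : ℝ} {μ : Measure X} [IsFiniteMeasure μ]

omit [SecondCountableTopology X] in
/-- If all small balls have measure at least `b`, there is a finite net with few points. -/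
lemma exists_finite_net {r b : ℝ} (hr : 0 < r) (hb : 0 < b)
    (h : ∀ x, b ≤ μ.real (Metric.closedBall x (r / 3))) :
    ∃ s : Finset X, (∀ x, ∃ y ∈ s, dist x y ≤ r) ∧ s.card * b ≤ μ.real Set.univ := by
  classical
  let P : Finset X → Prop := fun s => (s : Set X).Pairwise fun x y => r < dist x y
  have hP : ∀ s, P s → s.card * b ≤ μ.real Set.univ := by
    intro s hs
    have hdisj : (s : Set X).PairwiseDisjoint fun x => Metric.closedBall x (r / 3) := by
      intro x hx y hy hxy
      refine Metric.closedBall_disjoint_closedBall ?_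
      have := hs hx hy hxy
      linarith
    calc s.card * b = ∑ _x ∈ s, b := by rw [Finset.sum_const, nsmul_eq_mul]
      _ ≤ ∑ x ∈ s, μ.real (Metric.closedBall x (r / 3)) := Finset.sum_le_sum fun x _ => h x
      _ = μ.real (⋃ x ∈ s, Metric.closedBall x (r / 3)) :=
        (measureReal_biUnion_finset hdisj fun x _ => measurableSet_closedBall).symm
      _ ≤ μ.real Set.univ := measureReal_mono (Set.subset_univ _)
  -- The balls of radius `r / 3` about `r`-separated points are disjoint, so volume bounds the size
  -- of such sets. One of maximal size is an `r`-net, since a point far from it could be added.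
  let N : Set ℕ := {n | ∃ s, P s ∧ s.card = n}
  have hne : N.Nonempty := ⟨0, ∅, by simp [P], rfl⟩
  have hbdd : BddAbove N := by
    refine ⟨⌊μ.real Set.univ / b⌋₊, ?_⟩
    rintro _ ⟨s, hs, rfl⟩
    refine Nat.le_floor ?_
    rw [le_div_iff₀ hb]
    exact hP s hs
  obtain ⟨s, hs, hcard⟩ := Nat.sSup_mem hne hbdd
  refine ⟨s, fun x => ?_, hP s hs⟩
  by_contra! hx
  have hxs : x ∉ s := fun hmem => by
    have := hx x hmem
    rw [dist_self] at this
    linarith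
  have hins : P (insert x s) := by
    simp only [P, Finset.coe_insert]
    refine Set.Pairwise.insert hs fun y hy _ => ⟨hx y hy, ?_⟩
    rw [dist_comm]
    exact hx y hy
  have := le_csSup hbdd ⟨_, hins, rfl⟩
  rw [Finset.card_insert_of_notMem hxs] at this
  omega

omit [SecondCountableTopology X] in
/-- A measurable choice of a point in a finite net. -/
lemma exists_simpleFunc_net {r : ℝ} {s : Finset X} (hs : ∀ x, ∃ y ∈ s, dist x y ≤ r) :
    ∃ a : X → s, Measurable a ∧ ∀ x : X, dist x (a x) ≤ r := by
  classical
  rcases isEmpty_or_nonempty X with hX | ⟨⟨x₀⟩⟩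
  · exact ⟨isEmptyElim, measurable_of_empty _, isEmptyElim⟩
  obtain ⟨y₀, hy₀, -⟩ := hs x₀
  -- `nearestPt e s.card` also inspects the index `s.card`, so the default value must lie in `s`.
  let e : ℕ → X := fun n => if h : n < s.card then s.equivFin.symm ⟨n, h⟩ else y₀
  have he : ∀ n, e n ∈ s := fun n => by
    simp only [e]
    split_ifs
    · exact Subtype.coe_prop _
    · exact hy₀
  have hmem : ∀ x, SimpleFunc.nearestPt e s.card x ∈ s := fun x => by
    rw [SimpleFunc.nearestPt, SimpleFunc.map_apply]
    exact he _
  refine ⟨fun x => ⟨SimpleFunc.nearestPt e s.card x, hmem x⟩,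
    (SimpleFunc.nearestPt e s.card).measurable.subtype_mk, fun x => ?_⟩
  obtain ⟨y, hy, hxy⟩ := hs x
  have h1 : e (s.equivFin ⟨y, hy⟩) = y := by
    simp only [e]
    rw [dif_pos (s.equivFin ⟨y, hy⟩).2]
    simp
  have h2 := SimpleFunc.edist_nearestPt_le e x (s.equivFin ⟨y, hy⟩).2.le
  rw [h1, edist_dist, edist_dist, ENNReal.ofReal_le_ofReal_iff dist_nonneg, dist_comm,
    dist_comm y] at h2
  exact h2.trans hxy

/-- The integrand `(f x - f y) ^ 2` restricted to the `r`-neighbourhood of the diagonal. -/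
noncomputable def nearDiff (f : X → ℝ) (r : ℝ) : X × X → ℝ :=
  {p : X × X | dist p.1 p.2 ≤ r}.indicator fun p => (f p.1 - f p.2) ^ 2

omit [SecondCountableTopology X] [MeasurableSpace X] [BorelSpace X] in
lemma nearDiff_nonneg (f : X → ℝ) (r : ℝ) (p : X × X) : 0 ≤ nearDiff f r p :=
  Set.indicator_nonneg (fun _ _ => sq_nonneg _) p

lemma integrable_nearDiff (f : Lp ℝ 2 μ) (r : ℝ) : Integrable (nearDiff f r) (μ.prod μ) := by
  have hf := (Lp.stronglyMeasurable f).measurable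
  have hf2 : Integrable (fun x => f x ^ 2) μ := (Lp.memLp f).integrable_sq
  refine Integrable.indicator ?_ (measurableSet_dist_le r)
  refine (((hf2.comp_fst μ).const_mul 2).add ((hf2.comp_snd μ).const_mul 2)).mono'
    (by fun_prop) (Eventually.of_forall fun p => ?_)
  rw [Real.norm_eq_abs, abs_of_nonneg (sq_nonneg _)]
  simp only [Pi.add_apply]
  nlinarith [sq_nonneg (f p.1 + f p.2)]

omit [MetricSpace X] [SecondCountableTopology X] [BorelSpace X] in
/-- Jensen's inequality for the deviation from an average. -/
lemma sq_sub_setAverage_le {f : X → ℝ} (hf : MemLp f 2 μ) {B : Set X} (hB : 0 < μ.real B) (c : ℝ) :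
    (c - (μ.real B)⁻¹ * ∫ z in B, f z ∂μ) ^ 2 ≤ (μ.real B)⁻¹ * ∫ z in B, (c - f z) ^ 2 ∂μ := by
  have hfB : MemLp f 2 (μ.restrict B) := hf.restrict B
  have h1 : Integrable f (μ.restrict B) := hfB.integrable one_le_two
  have h2 : Integrable (fun z => (c - f z) ^ 2) (μ.restrict B) :=
    ((memLp_const c).sub hfB).integrable_sq
  set e := (μ.real B)⁻¹ * ∫ z in B, f z ∂μ with he
  have h3 : ∫ z in B, f z ∂μ = μ.real B * e := by
    rw [he]
    field_simp
  have h4 : 0 ≤ ∫ z in B, ((c - f z) - (c - e)) ^ 2 ∂μ := integral_nonneg fun z => sq_nonneg _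
  have h5 : ∫ z in B, ((c - f z) - (c - e)) ^ 2 ∂μ =
      ∫ z in B, (c - f z) ^ 2 ∂μ - μ.real B * (c - e) ^ 2 := by
    have : ∀ z, ((c - f z) - (c - e)) ^ 2 =
        (c - f z) ^ 2 + 2 * (c - e) * f z + (-2 * (c - e) * c + (c - e) ^ 2) := fun z => by ring
    simp only [this]
    have h6 : Integrable (fun z => (c - f z) ^ 2 + 2 * (c - e) * f z) (μ.restrict B) :=
      h2.add (h1.const_mul _)
    rw [integral_add h6 (integrable_const _),
      integral_add h2 (h1.const_mul _), integral_const_mul, h3, integral_const]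
    simp only [measureReal_restrict_apply_univ, smul_eq_mul]
    ring
  rw [le_inv_mul_iff₀ hB]
  linarith

/-- Approximation by step functions subordinate to a finite net. -/
lemma exists_submodule_approx_net {r κ : ℝ} (hκ : 0 < κ)
    (hball : ∀ x, κ ≤ μ.real (Metric.closedBall x r)) {s : Finset X}
    (hs : ∀ x, ∃ y ∈ s, dist x y ≤ r) :
    ∃ V : Submodule ℝ (Lp ℝ 2 μ), FiniteDimensional ℝ V ∧ Module.finrank ℝ V ≤ s.card ∧
      ∀ f : Lp ℝ 2 μ, ∃ h ∈ V, ‖f - h‖ ^ 2 ≤ κ⁻¹ * ∫ p, nearDiff f (2 * r) p ∂(μ.prod μ) := by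
  obtain ⟨a, ha, har⟩ := exists_simpleFunc_net hs
  have hmem : ∀ c : s → ℝ, MemLp (fun x => c (a x)) 2 μ := fun c =>
    MemLp.of_bound (Measurable.of_discrete.comp ha).aestronglyMeasurable (∑ y, ‖c y‖)
      (Eventually.of_forall fun x =>
        Finset.single_le_sum (f := fun y => ‖c y‖) (fun _ _ => norm_nonneg _) (Finset.mem_univ _))
  let Φ : (s → ℝ) →ₗ[ℝ] Lp ℝ 2 μ :=
    { toFun := fun c => (hmem c).toLp
      map_add' := fun _ _ => rfl
      map_smul' := fun _ _ => rfl }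
  refine ⟨LinearMap.range Φ, inferInstance, ?_, fun f => ?_⟩
  · simpa using LinearMap.finrank_range_le Φ
  -- Approximate `f x` by its average over the ball about the net point `a x`. Every point of that
  -- ball is within `2 * r` of `x`, so Jensen bounds the error by `nearDiff f (2 * r)`.
  let F : s → ℝ := fun y => (μ.real (Metric.closedBall (y : X) r))⁻¹ *
    ∫ z in Metric.closedBall (y : X) r, f z ∂μ
  refine ⟨Φ F, ⟨F, rfl⟩, ?_⟩
  have hΦ : ∀ᵐ x ∂μ, (f - Φ F : Lp ℝ 2 μ) x = f x - F (a x) := by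
    filter_upwards [Lp.coeFn_sub f (Φ F), (hmem F).coeFn_toLp] with x h1 h2
    rw [h1, Pi.sub_apply]
    exact congrArg _ h2
  have hint := integrable_nearDiff f (2 * r)
  rw [← real_inner_self_eq_norm_sq, L2.inner_def, integral_prod _ hint, ← integral_const_mul]
  refine integral_mono_of_nonneg (Eventually.of_forall fun x => real_inner_self_nonneg)
    (hint.integral_prod_left.const_mul _) ?_
  filter_upwards [hΦ, hint.prod_right_ae] with x hx hxi
  simp only [hx, real_inner_self_eq_norm_sq, Real.norm_eq_abs, sq_abs]
  have hB := hball (a x)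
  have hB0 := hκ.trans_le hB
  refine (sq_sub_setAverage_le (Lp.memLp f) hB0 (f x)).trans ?_
  refine mul_le_mul (inv_anti₀ hκ hB) ?_ (integral_nonneg fun _ => sq_nonneg _) (by positivity)
  rw [← integral_indicator measurableSet_closedBall]
  refine integral_mono_of_nonneg
    (Eventually.of_forall fun z => Set.indicator_nonneg (fun _ _ => sq_nonneg _) z) hxi
    (Eventually.of_forall fun z => ?_)
  by_cases hz : z ∈ Metric.closedBall (a x : X) r
  · have : dist x z ≤ 2 * r := by
      have h1 := dist_triangle x (a x) z
      have h2 := har x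
      rw [Metric.mem_closedBall, dist_comm] at hz
      linarith
    simp only [nearDiff]
    rw [Set.indicator_of_mem hz, Set.indicator_of_mem (by exact this)]
  · simp only
    rw [Set.indicator_of_notMem hz]
    exact nearDiff_nonneg _ _ _

omit [SecondCountableTopology X] [MeasurableSpace X] [BorelSpace X] in
/-- The kernel `d ^ (-δ)` dominates a sum over dyadic scales. -/
lemma sum_nearDiff_le_logKernel (hδ : 0 < δ) {r₀ : ℝ} (hr₀ : 0 < r₀) (f : X → ℝ) (m : ℕ)
    (p : X × X) :
    ∑ k ∈ Finset.range m, ((r₀ * (1 / 2) ^ k) ^ δ)⁻¹ * nearDiff f (2 * (r₀ * (1 / 2) ^ k)) p ≤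
      2 ^ δ / (2 ^ δ - 1) * 2 ^ δ * logKernel δ f f p := by
  have hq : (1 : ℝ) < 2 ^ δ := Real.one_lt_rpow one_lt_two hδ
  set q : ℝ := 2 ^ δ with hqdef
  rcases (dist_nonneg (x := p.1) (y := p.2)).eq_or_lt with h0 | h0
  · have h1 : p.1 = p.2 := dist_eq_zero.1 h0.symm
    have : ∀ r, nearDiff f r p = 0 := fun r => by simp [nearDiff, h1, Set.indicator]
    simp [this, logKernel, h1]
  set d := dist p.1 p.2 with hd
  -- Scale `k` sees the pair exactly when `d ≤ 2 * r₀ / 2 ^ k`, that is when `q ^ k ≤ A`.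
  set A : ℝ := (2 * r₀ / d) ^ δ with hA
  have hscale : ∀ k : ℕ, ((r₀ * (1 / 2) ^ k) ^ δ)⁻¹ = (r₀ ^ δ)⁻¹ * q ^ k := fun k => by
    rw [Real.mul_rpow hr₀.le (by positivity), mul_inv, hqdef, one_div, inv_pow,
      Real.inv_rpow (by positivity), inv_inv, ← Real.rpow_natCast, ← Real.rpow_natCast,
      ← Real.rpow_mul zero_le_two, ← Real.rpow_mul zero_le_two, mul_comm δ]
  have hterm : ∀ k : ℕ, ((r₀ * (1 / 2) ^ k) ^ δ)⁻¹ * nearDiff f (2 * (r₀ * (1 / 2) ^ k)) p =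
      (r₀ ^ δ)⁻¹ * (f p.1 - f p.2) ^ 2 * (if q ^ k ≤ A then q ^ k else 0) := fun k => by
    rw [hscale]
    have hiff : d ≤ 2 * (r₀ * (1 / 2) ^ k) ↔ q ^ k ≤ A := by
      have h2 : q ^ k = ((2 : ℝ) ^ k) ^ δ := by
        rw [hqdef, ← Real.rpow_natCast, ← Real.rpow_natCast, ← Real.rpow_mul zero_le_two,
          ← Real.rpow_mul zero_le_two, mul_comm δ]
      rw [h2, hA, Real.rpow_le_rpow_iff (by positivity) (by positivity) hδ, le_div_iff₀ h0,
        one_div, inv_pow, ← mul_assoc, ← div_eq_mul_inv, le_div_iff₀ (by positivity), mul_comm]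
    by_cases h : q ^ k ≤ A
    · rw [if_pos h, nearDiff, Set.indicator_of_mem (by exact hiff.2 h)]
      ring
    · rw [if_neg h, nearDiff, Set.indicator_of_notMem (by exact fun h' => h (hiff.1 h'))]
      ring
  rw [Finset.sum_congr rfl fun k _ => hterm k, ← Finset.mul_sum]
  refine (mul_le_mul_of_nonneg_left (sum_geometric_le_of_threshold hq (by positivity) m)
    (by positivity)).trans (le_of_eq ?_)
  rw [logKernel, ← hd, hA, Real.div_rpow (by positivity) h0.le, Real.mul_rpow zero_le_two hr₀.le,
    ← hqdef]
  have h1 : r₀ ^ δ ≠ 0 := (Real.rpow_pos_of_pos hr₀ _).ne'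
  have h2 : d ^ δ ≠ 0 := (Real.rpow_pos_of_pos h0 _).ne'
  have h3 : q - 1 ≠ 0 := (sub_pos.2 hq).ne'
  field_simp

/-- Functions of finite energy are approximated in subspaces of exponentially growing dimension. -/
theorem exists_submodule_approx_logForm (hδ : 0 < δ) (hμ : IsAhlforsRegular δ μ) :
    ∃ V : ℕ → Submodule ℝ (Lp ℝ 2 μ), (∀ m, FiniteDimensional ℝ (V m)) ∧ ∃ c B q : ℝ,
      0 < c ∧ 0 ≤ B ∧ 1 ≤ q ∧ (∀ m, (Module.finrank ℝ (V m) : ℝ) ≤ B * q ^ m) ∧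
      ∀ m (f : logFormDomain δ μ), ∃ h : ℕ → Lp ℝ 2 μ, (∀ k < m, h k ∈ V m) ∧
        ∑ k ∈ Finset.range m, ‖(f : Lp ℝ 2 μ) - h k‖ ^ 2 ≤ c * logForm δ μ f f := by
  rcases subsingleton_or_nontrivial X with hX | hX
  -- On at most one point the diameter is `0` and regularity says nothing, but `L²` is spanned by
  -- the constant `1`.
  · let o : Lp ℝ 2 μ := (memLp_const (1 : ℝ)).toLp
    have ho : ∀ f : Lp ℝ 2 μ, f ∈ Submodule.span ℝ {o} := fun f => by
      rcases isEmpty_or_nonempty X with hX | ⟨⟨x₀⟩⟩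
      · have : f = 0 := Lp.ext (Eventually.of_forall fun x => isEmptyElim x)
        rw [this]
        exact zero_mem _
      · refine Submodule.mem_span_singleton.2 ⟨f x₀, Lp.ext ?_⟩
        filter_upwards [Lp.coeFn_smul (f x₀) o, (memLp_const (1 : ℝ)).coeFn_toLp] with x h1 h2
        rw [h1, Pi.smul_apply, h2, smul_eq_mul, mul_one, Subsingleton.elim x x₀]
    refine ⟨fun _ => Submodule.span ℝ {o}, fun _ => inferInstance, 1, 1, 1, one_pos, zero_le_one,
      le_rfl, fun m => ?_, fun m f => ⟨fun _ => f, fun _ _ => ho f, ?_⟩⟩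
    · have := finrank_span_le_card (R := ℝ) ({o} : Set (Lp ℝ 2 μ))
      simp only [one_pow, mul_one]
      exact_mod_cast this.trans (by simp)
    · simp only [sub_self, norm_zero, one_mul, logForm_eq_inner]
      simp
  obtain ⟨C, hC, hball⟩ := hμ
  have hC0 : 0 < C := by linarith
  obtain ⟨r₀, hr₀, hdiam⟩ := exists_pos_ofReal_lt_ediam (X := X)
  let r : ℕ → ℝ := fun k => r₀ * (1 / 2) ^ k
  have hr : ∀ k, 0 < r k := fun k => by positivity
  have hrle : ∀ k, r k ≤ r₀ := fun k =>
    mul_le_of_le_one_right hr₀.le (pow_le_one₀ (by norm_num) (by norm_num))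
  have hlow : ∀ s : ℝ, 0 ≤ s → s ≤ r₀ → ∀ x, C⁻¹ * s ^ δ ≤ μ.real (Metric.closedBall x s) := by
    intro s hs hs' x
    have h := (hball x s hs ((ENNReal.ofReal_le_ofReal hs').trans_lt hdiam)).1
    exact (ENNReal.ofReal_le_iff_le_toReal (measure_ne_top _ _)).1 h
  have hstep : ∀ k, ∃ V : Submodule ℝ (Lp ℝ 2 μ), FiniteDimensional ℝ V ∧
      Module.finrank ℝ V * (C⁻¹ * (r k / 3) ^ δ) ≤ μ.real Set.univ ∧
      ∀ f : Lp ℝ 2 μ, ∃ h ∈ V, ‖f - h‖ ^ 2 ≤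
        (C⁻¹ * r k ^ δ)⁻¹ * ∫ p, nearDiff f (2 * r k) p ∂(μ.prod μ) := by
    intro k
    have hrk := hr k
    obtain ⟨s, hs, hcard⟩ := exists_finite_net (μ := μ) hrk
      (b := C⁻¹ * (r k / 3) ^ δ) (by positivity)
      (hlow _ (by positivity) (by linarith [hrle k]))
    obtain ⟨V, hV, hdim, happ⟩ := exists_submodule_approx_net (μ := μ) (r := r k)
      (κ := C⁻¹ * r k ^ δ) (by positivity) (hlow _ hrk.le (hrle k)) hs
    refine ⟨V, hV, le_trans ?_ hcard, happ⟩
    have : (Module.finrank ℝ V : ℝ) ≤ s.card := by exact_mod_cast hdim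
    exact mul_le_mul_of_nonneg_right this (by positivity)
  choose W hW hdim happ using hstep
  have hq : (1 : ℝ) < 2 ^ δ := Real.one_lt_rpow one_lt_two hδ
  set q : ℝ := 2 ^ δ with hqdef
  have hq1 : 0 < q - 1 := sub_pos.2 hq
  set B : ℝ := μ.real Set.univ * C * 3 ^ δ / r₀ ^ δ with hB
  have hB0 : 0 ≤ B := by positivity
  have hdimW : ∀ k, (Module.finrank ℝ (W k) : ℝ) ≤ B * q ^ k := fun k => by
    have hrk := hr k
    have h1 := hdim k
    rw [← le_div_iff₀ (by positivity)] at h1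
    refine h1.trans (le_of_eq ?_)
    have h2 : (r k / 3) ^ δ = r₀ ^ δ / (3 ^ δ * q ^ k) := by
      simp only [r]
      rw [Real.div_rpow hrk.le (by norm_num), Real.mul_rpow hr₀.le (by positivity), one_div, inv_pow,
        Real.inv_rpow (by positivity), hqdef, ← Real.rpow_natCast, ← Real.rpow_natCast,
        ← Real.rpow_mul zero_le_two, ← Real.rpow_mul zero_le_two, mul_comm δ]
      field_simp
    have h3 : r₀ ^ δ ≠ 0 := (Real.rpow_pos_of_pos hr₀ _).ne'
    have h4 : (3 : ℝ) ^ δ ≠ 0 := (Real.rpow_pos_of_pos (by norm_num) _).ne'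
    rw [h2, hB]
    field_simp
  clear_value B
  -- In `c`, the `2` undoes the `1 / 2` of the form, `C` is from the lower ball bound, `q / (q - 1)`
  -- from the geometric sum and the last `q = 2 ^ δ` from the doubled radius.
  refine ⟨fun m => (Finset.range m).sup W, fun m => Submodule.finiteDimensional_finset_sup _ _,
    2 * (C * (q / (q - 1) * q)), B / (q - 1), q, by positivity, by positivity, hq.le, fun m => ?_,
    fun m f => ?_⟩
  · have h1 : (Module.finrank ℝ ((Finset.range m).sup W : Submodule ℝ (Lp ℝ 2 μ)) : ℝ) ≤
        ∑ k ∈ Finset.range m, B * q ^ k := by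
      induction m with
      | zero =>
        rw [Finset.range_zero, Finset.sup_empty, finrank_bot]
        simp
      | succ m ih =>
        have := Submodule.finiteDimensional_finset_sup (Finset.range m) W
        rw [Finset.range_add_one, Finset.sup_insert, Finset.sum_insert Finset.notMem_range_self]
        have h2 : (Module.finrank ℝ
            (W m ⊔ (Finset.range m).sup W : Submodule ℝ (Lp ℝ 2 μ)) : ℝ) ≤
            Module.finrank ℝ (W m) +
              Module.finrank ℝ ((Finset.range m).sup W : Submodule ℝ (Lp ℝ 2 μ)) := by
          exact_mod_cast Submodule.finrank_add_le_finrank_add_finrank _ _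
        linarith [hdimW m]
    refine h1.trans ?_
    rw [← Finset.mul_sum, geom_sum_eq hq.ne', div_mul_eq_mul_div, ← mul_div_assoc,
      div_le_div_iff_of_pos_right hq1]
    exact mul_le_mul_of_nonneg_left (by linarith) hB0
  · choose h hhW hh using fun k => happ k f
    refine ⟨h, fun k hk => (Finset.le_sup (f := W) (Finset.mem_range.2 hk)) (hhW k), ?_⟩
    have hf : Integrable (logKernel δ (f : Lp ℝ 2 μ) (f : Lp ℝ 2 μ)) (μ.prod μ) := f.2
    have hi : ∀ k ∈ Finset.range m, Integrable
        (fun p => (r k ^ δ)⁻¹ * nearDiff (f : Lp ℝ 2 μ) (2 * r k) p) (μ.prod μ) :=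
      fun k _ => (integrable_nearDiff _ _).const_mul _
    calc ∑ k ∈ Finset.range m, ‖(f : Lp ℝ 2 μ) - h k‖ ^ 2
        ≤ ∑ k ∈ Finset.range m, C * ∫ p, (r k ^ δ)⁻¹ * nearDiff (f : Lp ℝ 2 μ) (2 * r k) p
            ∂(μ.prod μ) := by
          refine Finset.sum_le_sum fun k _ => (hh k).trans (le_of_eq ?_)
          rw [mul_inv, inv_inv, integral_const_mul, mul_assoc]
      _ = C * ∫ p, ∑ k ∈ Finset.range m, (r k ^ δ)⁻¹ * nearDiff (f : Lp ℝ 2 μ) (2 * r k) p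
            ∂(μ.prod μ) := by
          rw [← Finset.mul_sum, integral_finsetSum _ hi]
      _ ≤ C * ∫ p, q / (q - 1) * q * logKernel δ (f : Lp ℝ 2 μ) (f : Lp ℝ 2 μ) p
            ∂(μ.prod μ) := by
          refine mul_le_mul_of_nonneg_left ?_ hC0.le
          exact integral_mono (integrable_finsetSum _ hi) (hf.const_mul _) fun p =>
            sum_nearDiff_le_logKernel hδ hr₀ _ m p
      _ = 2 * (C * (q / (q - 1) * q)) * logForm δ μ f f := by
          rw [logForm, LinearMap.mk₂_apply, integral_const_mul]
          ring

end Approximation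

/-! ### The heat semigroup of the logarithmic Dirichlet Laplacian -/

theorem corollary3p6 {X : Type*} [MetricSpace X] [LocallyCompactSpace X]
    [SecondCountableTopology X] [MeasurableSpace X] [BorelSpace X]
    (μ : Measure X) [IsFiniteMeasure μ] (δ : ℝ) (hδ : 0 < δ) (hμ : IsAhlforsRegular δ μ) :
    ∃ S : ℝ≥0 → Lp ℝ 2 μ →L[ℝ] Lp ℝ 2 μ,
      IsHeatSemigroup (logDirichletLaplacian δ μ) S ∧
      (∀ S' : ℝ≥0 → Lp ℝ 2 μ →L[ℝ] Lp ℝ 2 μ,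
        IsHeatSemigroup (logDirichletLaplacian δ μ) S' → S' = S) ∧
      ∃ t₀ : ℝ≥0, 0 < t₀ ∧ ∀ t : ℝ≥0, t₀ < t → IsTraceClass (S t) := by
  classical
  obtain ⟨V, hVf, c, B, q, hc, hB, hq, hdim, happ⟩ := exists_submodule_approx_logForm hδ hμ
  have hV : ∀ m (f : logFormDomain δ μ),
      m * ‖(f : Lp ℝ 2 μ) - (V m).starProjection f‖ ^ 2 ≤ c * logForm δ μ f f := by
    intro m f
    obtain ⟨h, hh, hsum⟩ := happ m f
    refine le_trans ?_ hsum
    have h1 : ∀ k ∈ Finset.range m, ‖(f : Lp ℝ 2 μ) - (V m).starProjection f‖ ^ 2 ≤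
        ‖(f : Lp ℝ 2 μ) - h k‖ ^ 2 := fun k hk => by
      gcongr
      rw [Submodule.starProjection_minimal]
      exact ciInf_le ⟨0, by rintro _ ⟨x, rfl⟩; exact norm_nonneg _⟩
        (⟨h k, hh k (Finset.mem_range.1 hk)⟩ : V m)
    simpa using Finset.card_nsmul_le_sum _ _ _ h1
  obtain ⟨w, b, l, hl, hgraph, hcard⟩ := exists_hilbertBasis_formOperator (logGradientLp δ μ)
    logForm_eq_inner isClosed_graph_logGradientLp (dense_logFormDomain hδ hμ) V c hc.le hV
  have hexp : ∀ (t : ℝ≥0) i, |Real.exp (-(t * l i))| ≤ 1 := fun t i => by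
    rw [Real.abs_exp, Real.exp_le_one_iff]
    have := mul_nonneg t.2 (hl i)
    simpa using this
  choose S hS using fun t : ℝ≥0 => b.exists_diagonal (fun i => Real.exp (-(t * l i))) (hexp t)
  have hsemi : IsHeatSemigroup (logDirichletLaplacian δ μ) S := b.isHeatSemigroup hl hgraph hS
  refine ⟨S, hsemi, fun S' hS' => hsemi.eq_of_hilbertBasis hS' b l fun i => (hgraph _ _).2
    -- Any `t > c * log q` would do; the `+ 1` keeps `t₀` positive when `q = 1`.
    fun j => ?_, (c * Real.log q).toNNReal + 1, by positivity, fun t ht => ?_⟩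
  · rw [map_smul, lp.coeFn_smul, Pi.smul_apply, smul_eq_mul, b.repr_self, lp.single_apply,
      Pi.single_apply]
    split_ifs with hij
    · rw [hij]
    · simp
  · refine b.isTraceClass (fun i => (Real.exp_pos _).le) ?_ (hS t)
    refine summable_exp_neg_of_card_le hl hc hq hB (fun m a ham s hs => ?_) (t := t) ?_
    · refine le_trans ?_ (hdim m)
      exact_mod_cast hcard m a ham s hs
    · have h1 : ((c * Real.log q).toNNReal : ℝ) + 1 < t := by exact_mod_cast ht
      have h2 := Real.le_coe_toNNReal (c * Real.log q)
      linarith
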